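/- **Setting.** Let $f:\mathbb R\to\mathbb R$ be $C^1$ and strictly increasing, and let $\kappa,u_a$ be measurable functions of $t$ that are bounded on each $[0,T]$. Consider $$v_t+(vf(u))_x=0,\qquad (vu)_t+(vuf(u))_x=\kappa(t)(u_a(t)-u)v,\qquad x\in\mathbb R,\ t>0,$$ with initial data $(v,u)(x,0)=(v_0,u_0)$ for $x\le R$ and $(v(x),u(x))$ for $x>R$, where $v_0>0$, $u_0\in\mathbb R$, $v$ is positive and bounded on $[R,\infty)$, and $u$ is bounded and continuous on $[R,\infty)$ with finitely many extremes (finitely many turning points, between which it is monotone). Let $\varepsilon_\nu>0$, $\varepsilon_\nu\to0$, let $C_1,C_2\ge1$, $\alpha\in(0,1)$ and $\rho(\varepsilon)\to0$ as $\varepsilon\to0^+$, and let $R=Y^\nu_0<Y^\nu_1<\cdots$ satisfy $C_1\varepsilon_\nu^\alpha<Y^\nu_{i+1}-Y^\nu_i<C_2\,\rho(\varepsilon_\nu)$ for all $i\ge 0$. **The approximate solutions** $U^\nu=(v^\nu,u^\nu)$ obtained by shadow wave tracking are as follows; write $Y_i$, $\varepsilon$ for $Y^\nu_i$, $\varepsilon_\nu$.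 *States.* The states are $(v_0,u_0)$ and $(v_i,u_i)=(v(Y_i),u(Y_i))$, $i\ge1$, initially on $(-\infty,Y_0]$ and $(Y_{i-1},Y_i]$. At time $t$ the $i$-th state is $(v_i,U_i(t))$, where $U_i$ solves $U_i'=\kappa(u_a-U_i)$, $U_i(0)=u_i$, that is $$U_i(t)=e^{-\int_0^t\kappa}\Big(\int_0^t\kappa(\theta) u_a(\theta)e^{\int_0^\theta\kappa}\,d\theta+u_i\Big).$$ *Initial waves.* If $u_i\le u_{i+1}$, two contact discontinuities $Y_i+\int_0^tf(U_i)$ and $Y_i+\int_0^tf(U_{i+1})$ leave $Y_i$ and enclose a vacuum, in which $v=0$ and $u=z(x,t)$ is continuous for $t>0$, equals $U_i(t)$ and $U_{i+1}(t)$ at the contacts, and lies between these values. If $u_i>u_{i+1}$, a shadow wave leaves $Y_i$ with mass $\xi(0)=0$. *Shadow waves.* A shadow wave between a left and a right medium (states, or vacua with $v=0$) has a central line $c(t)$, a mass $\xi(t)$ and a velocity $\chi(t)$ with $$\dot c=f(\chi),\qquad \dot\xi=\dot c\,[v]-[vf(U)],\qquad (\xi\chi)'+\kappa(\chi-u_a)\xi=\dot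 c\,[vU]-[vUf(U)]$$ (in integrated form), where $[\cdot]$ is the right value minus the left value; $c,\xi,\xi\chi$ are continuous up to the ends of its life. It is admissible (overcompressive): $f(\chi)<f(U_l)$ if its left medium is a state with velocity $U_l$, and $f(\chi)>f(U_r)$ if its right medium is a state with velocity $U_r$. *Interactions.* Neighbouring waves, not both contacts, interact exactly when their central lines meet. The media between the waves that meet are eliminated, and a single shadow wave starts at the meeting point with the sum of the incoming masses and of the incoming momenta $\xi\chi$ (contacts carry none). At any time media arbitrarily far to the right are still present. *The function $U^\nu$.* Around the central line of a shadow wave born at time $T$ there is a strip of half-width $h(t)=\frac{\varepsilon}{2}(t-T)+x_\varepsilon$, with $x_\varepsilon=0$ if $T=0$ and $0<x_\varepsilon\le C\varepsilon$ otherwise. In the strip $U^\nu$ equals an inner state $(v_\varepsilon(t),u_\varepsilon(t))$ with $|2h(t)v_\varepsilon(t)-\xi(t)|\le\delta_\nu\xi(t)$ and $|u_\varepsilon(t)-\chi(t)|\le\delta_\nu$. Here the constant $C$ and the sequence $\delta_\nu\to0$ do not depend on the wave, and $C$ does not depend on $\nu$. Where several strips overlap, $U^\nu$ is the inner state of one of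 them. Outside all the strips $U^\nu$ is the value of the medium in which $(x,t)$ lies. **Theorem 1.2.** Let $(U^\nu)_{\nu\ge 0}$ be a sequence of such (measurable) approximate solutions. Then $(U^\nu)$ is locally uniformly bounded: for each compact $K\subset\mathbb R\times[0,\infty)$ there is $M_K$ such that, for all $\nu$, $v^\nu$ is integrable on $K$, $\int_K|v^\nu|\,dx\,dt\le M_K$ and $|u^\nu|\le M_K$ a.e. on $K$. Moreover there are a subsequence $(U^{\nu_j})$ and a Radon measure $U^*=(v^*,u^*)$ on $\mathbb R\times[0,\infty)$, with $v^*$ nonnegative and $u^*$ signed, such that $U^{\nu_j}\stackrel{*}{\rightharpoonup}U^*$, that is $$\int \varphi\,v^{\nu_j}\,dx\,dt\to\int\varphi\,dv^*,\qquad \int \varphi\,u^{\nu_j}\,dx\,dt\to\int\varphi\,du^*\qquad\text{for all }\varphi\in C_c(\mathbb R\times[0,\infty)).$$ -/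

import Mathlib

open MeasureTheory Filter Topology Set
open scoped ENNReal

/-! ### The relaxation law along characteristics -/

/-- Solution at time `t` of `w' = κ (u_a - w)`, `w 0 = w₀`, by variation of constants:
`exp (-∫₀ᵗ κ) * (∫₀ᵗ κ u_a exp (∫₀^θ κ) dθ + w₀)`. -/
noncomputable def relax (κ ua : ℝ → ℝ) (w₀ t : ℝ) : ℝ :=
  Real.exp (-∫ θ in (0 : ℝ)..t, κ θ) *
    ((∫ θ in (0 : ℝ)..t, κ θ * ua θ * Real.exp (∫ s in (0 : ℝ)..θ, κ s)) + w₀)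

/-- The real function `g` is bounded on `[0, T]` for each `T`. -/
def LocallyBoundedOnTimes (g : ℝ → ℝ) : Prop :=
  ∀ T : ℝ, ∃ M : ℝ, ∀ t ∈ Icc 0 T, |g t| ≤ M

/-- `u` has finitely many extremes on `[R, ∞)`: away from a finite set of turning points it is
monotone or antitone. -/
def FinitelyManyExtremes (u : ℝ → ℝ) (R : ℝ) : Prop :=
  ∃ S : Finset ℝ, ∀ a b : ℝ, R ≤ a → a < b → (∀ x ∈ S, x ∉ Ioo a b) →
    MonotoneOn u (Icc a b) ∨ AntitoneOn u (Icc a b)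

/-- Piecewise constant approximation of a function: value `w₀` on the `0`-th cell `(-∞, Y 0]`,
and `w (Y (i+1))` on the cell `(Y i, Y (i+1)]`, which carries the number `i + 1`. -/
def cellValue (w₀ : ℝ) (w : ℝ → ℝ) (Y : ℕ → ℝ) : ℕ → ℝ
  | 0 => w₀
  | i + 1 => w (Y (i + 1))

/-! ### Media and fronts

The constant states and the vacua are numbered from left to right by *media*: medium `2 * i` is the
`i`-th constant state `(vs i, us i)`, moving with the speed `f (U_i t)` where
`U_i = relax κ ua (us i)`; medium `2 * i + 1` is the vacuum between the states `i` and `i + 1`.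
A *front* `(l, r)`, `l < r`, separates the medium `l` on its left from the medium `r` on its right,
all media strictly in between having been eliminated. A front `(k, k + 1)` is a contact
discontinuity between a state and an adjacent vacuum; a front `(l, r)` with `l + 2 ≤ r` is a shadow
wave (joining state to state, vacuum to state, state to vacuum, or vacuum to vacuum). -/

/-- Density of medium `m`; it vanishes in a vacuum. -/
def mediumDensity (vs : ℕ → ℝ) (m : ℕ) : ℝ := if Even m then vs (m / 2) else 0

/-- Velocity of medium `m = 2 * i`, a constant state, at time `t`. (For odd `m` it only occurs
multiplied by the density `0`.) -/
noncomputable def mediumVelocity (κ ua : ℝ → ℝ) (us : ℕ → ℝ) (m : ℕ) (t : ℝ) : ℝ :=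
  relax κ ua (us (m / 2)) t

/-- Path of the contact discontinuity between the media `k` and `k + 1`:
`Y i + ∫₀ᵗ f (U_i)` for `k = 2 * i`, and `Y i + ∫₀ᵗ f (U_{i+1})` for `k = 2 * i + 1`. -/
noncomputable def contactPath (f κ ua : ℝ → ℝ) (us Y : ℕ → ℝ) (k : ℕ) (t : ℝ) : ℝ :=
  Y (k / 2) + ∫ s in (0 : ℝ)..t, f (relax κ ua (us ((k + 1) / 2)) s)

/-- The time at which the front `(l, r)` appears, `death m` being the time at which the medium `m`
is eliminated: the last elimination among the media strictly between. -/
def frontBirth (death : ℕ → ℝ≥0∞) (l r : ℕ) : ℝ≥0∞ := (Finset.Ioo l r).sup death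

/-- The front `(l, r)` is present at time `t`. -/
def IsFrontAt (death : ℕ → ℝ≥0∞) (l r : ℕ) (t : ℝ) : Prop :=
  l < r ∧ 0 ≤ t ∧ frontBirth death l r ≤ ENNReal.ofReal t ∧
    ENNReal.ofReal t < death l ∧ ENNReal.ofReal t < death r

/-- The front `(l, r)` is present just before time `t`. -/
def IsFrontBefore (death : ℕ → ℝ≥0∞) (l r : ℕ) (t : ℝ) : Prop :=
  l < r ∧ 0 < t ∧ frontBirth death l r < ENNReal.ofReal t ∧
    ENNReal.ofReal t ≤ death l ∧ ENNReal.ofReal t ≤ death r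

/-- The closed life span of the front `(l, r)`, both end points included. -/
def lifeSpan (death : ℕ → ℝ≥0∞) (l r : ℕ) : Set ℝ :=
  {t | 0 ≤ t ∧ frontBirth death l r ≤ ENNReal.ofReal t ∧
    ENNReal.ofReal t ≤ death l ∧ ENNReal.ofReal t ≤ death r}

/-- `(l, r)` is a shadow wave that occurs, i.e. one that lives for a positive time. -/
def IsShadowWave (death : ℕ → ℝ≥0∞) (l r : ℕ) : Prop :=
  l + 2 ≤ r ∧ frontBirth death l r < death l ∧ frontBirth death l r < death r

open Classical in
/-- The fronts `(a, b)`, `l ≤ a < b ≤ r`, present just before time `t`. -/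
noncomputable def incoming (death : ℕ → ℝ≥0∞) (l r : ℕ) (t : ℝ) : Finset (ℕ × ℕ) :=
  ((Finset.Icc l r) ×ˢ (Finset.Icc l r)).filter fun p => IsFrontBefore death p.1 p.2 t

/-- The history of the waves produced by the tracking algorithm for
`v_t + (v f(u))_x = 0`, `(v u)_t + (v u f(u))_x = κ(t) (u_a(t) - u) v`
from the piecewise constant data with states `(vs i, us i)` and jumps at `Y i`. Each Riemann
problem at time `0` is solved by a shadow wave (if `us i > us (i+1)`) or by two contacts enclosing a
vacuum (if `us i ≤ us (i+1)`); when the central lines of neighbouring waves meet, the media between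
them are eliminated and one shadow wave emerges, carrying their total mass and momentum. -/
structure WaveHistory (f κ ua : ℝ → ℝ) (vs us Y : ℕ → ℝ) where
  /-- elimination time of each medium -/
  death : ℕ → ℝ≥0∞
  /-- central line of the front `(l, r)` -/
  c : ℕ → ℕ → ℝ → ℝ
  /-- mass (strength of the delta) carried by the front `(l, r)` -/
  ξ : ℕ → ℕ → ℝ → ℝ
  /-- velocity of the mass carried by the shadow wave `(l, r)` -/
  χ : ℕ → ℕ → ℝ → ℝ
  /-- the leftmost state is never eliminated -/
  death_zero : death 0 = ⊤
  /-- the constant states are all present at the beginning -/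
  death_even : ∀ i, 0 < death (2 * i)
  /-- a vacuum is present at the beginning between `us i ≤ us (i+1)` -/
  death_odd_pos : ∀ i, us i ≤ us (i + 1) → 0 < death (2 * i + 1)
  /-- no vacuum appears between `us i > us (i+1)` -/
  death_odd_zero : ∀ i, us (i + 1) < us i → death (2 * i + 1) = 0
  /-- at any time there remain media arbitrarily far to the right, so that each front has
  absorbed finitely many media only -/
  alive_unbounded : ∀ t : ℝ, ∀ n : ℕ, ∃ m, n ≤ m ∧ ENNReal.ofReal t < death m
  /-- contacts move along characteristics -/
  contact_path : ∀ k t, c k (k + 1) t = contactPath f κ ua us Y k t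
  /-- contacts carry no mass -/
  contact_mass : ∀ k t, ξ k (k + 1) t = 0
  /-- continuity of the path, the mass and the momentum of a shadow wave up to both ends -/
  continuous_path : ∀ l r, IsShadowWave death l r → ContinuousOn (c l r) (lifeSpan death l r)
  continuous_mass : ∀ l r, IsShadowWave death l r → ContinuousOn (ξ l r) (lifeSpan death l r)
  continuous_momentum : ∀ l r, IsShadowWave death l r →
    ContinuousOn (fun t => ξ l r t * χ l r t) (lifeSpan death l r)
  continuous_velocity : ∀ l r, IsShadowWave death l r →
    ContinuousOn (χ l r) {t ∈ lifeSpan death l r | frontBirth death l r < ENNReal.ofReal t}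
  /-- `c' = f(χ)`, integrated -/
  path_eq : ∀ l r, IsShadowWave death l r → ∀ s ∈ lifeSpan death l r, ∀ t ∈ lifeSpan death l r,
    frontBirth death l r < ENNReal.ofReal s → s ≤ t →
    c l r t - c l r s = ∫ τ in s..t, f (χ l r τ)
  /-- `ξ' = c' [v] - [v f(U)]`, integrated -/
  mass_eq : ∀ l r, IsShadowWave death l r → ∀ s ∈ lifeSpan death l r, ∀ t ∈ lifeSpan death l r,
    frontBirth death l r < ENNReal.ofReal s → s ≤ t →
    ξ l r t - ξ l r s = ∫ τ in s..t,
      (f (χ l r τ) * (mediumDensity vs r - mediumDensity vs l) -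
        (mediumDensity vs r * f (mediumVelocity κ ua us r τ) -
          mediumDensity vs l * f (mediumVelocity κ ua us l τ)))
  /-- `(ξ χ)' + κ (χ - u_a) ξ = c' [v U] - [v U f(U)]`, integrated -/
  momentum_eq : ∀ l r, IsShadowWave death l r →
    ∀ s ∈ lifeSpan death l r, ∀ t ∈ lifeSpan death l r,
    frontBirth death l r < ENNReal.ofReal s → s ≤ t →
    ξ l r t * χ l r t - ξ l r s * χ l r s = ∫ τ in s..t,
      (f (χ l r τ) * (mediumDensity vs r * mediumVelocity κ ua us r τ -
          mediumDensity vs l * mediumVelocity κ ua us l τ) -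
        (mediumDensity vs r * mediumVelocity κ ua us r τ * f (mediumVelocity κ ua us r τ) -
          mediumDensity vs l * mediumVelocity κ ua us l τ * f (mediumVelocity κ ua us l τ)) -
        κ τ * (χ l r τ - ua τ) * ξ l r τ)
  /-- admissibility (overcompressibility) against a constant state on the left -/
  admissible_left : ∀ l r, IsShadowWave death l r → Even l → ∀ t,
    frontBirth death l r < ENNReal.ofReal t → IsFrontAt death l r t →
    f (χ l r t) < f (mediumVelocity κ ua us l t)
  /-- admissibility (overcompressibility) against a constant state on the right -/
  admissible_right : ∀ l r, IsShadowWave death l r → Even r → ∀ t,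
    frontBirth death l r < ENNReal.ofReal t → IsFrontAt death l r t →
    f (mediumVelocity κ ua us r t) < f (χ l r t)
  /-- a shadow wave born at time `0` starts from the jump `Y i`, without mass -/
  initial_path : ∀ i, us (i + 1) < us i → c (2 * i) (2 * i + 2) 0 = Y i
  initial_mass : ∀ i, us (i + 1) < us i → ξ (2 * i) (2 * i + 2) 0 = 0
  /-- a shadow wave born at a time `T > 0` starts where all the incoming waves, at least one of them
  a shadow wave, meet -/
  interaction_path : ∀ l r, IsShadowWave death l r → ∀ T : ℝ, 0 < T →
    frontBirth death l r = ENNReal.ofReal T → ∀ p ∈ incoming death l r T,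
    c p.1 p.2 T = c l r T
  interaction_shadow : ∀ l r, IsShadowWave death l r → ∀ T : ℝ, 0 < T →
    frontBirth death l r = ENNReal.ofReal T → ∃ p ∈ incoming death l r T, p.1 + 2 ≤ p.2
  /-- conservation of mass in an interaction -/
  interaction_mass : ∀ l r, IsShadowWave death l r → ∀ T : ℝ, 0 < T →
    frontBirth death l r = ENNReal.ofReal T →
    ξ l r T = ∑ p ∈ incoming death l r T, ξ p.1 p.2 T
  /-- conservation of momentum in an interaction -/
  interaction_momentum : ∀ l r, IsShadowWave death l r → ∀ T : ℝ, 0 < T →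
    frontBirth death l r = ENNReal.ofReal T →
    ξ l r T * χ l r T = ∑ p ∈ incoming death l r T, ξ p.1 p.2 T * χ p.1 p.2 T
  /-- neighbouring waves, not both contacts, do not meet without interacting -/
  separated : ∀ l m r t, IsFrontAt death l m t → IsFrontAt death m r t →
    (l + 2 ≤ m ∨ m + 2 ≤ r) → c l m t < c m r t

/-- The shadow wave approximation `U^ε = (v, u)` obtained from a wave history by replacing the
central line of each shadow wave by a strip of half-width `ε / 2 * (t - T) + x_ε`, `T` the birth
time, with inner state `(v_ε(t), u_ε(t))`. The offset `x_ε` is `0` for a wave born at time `0` and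
lies in `(0, C ε]` otherwise; `2 (ε / 2 * (t - T) + x_ε) v_ε(t)` is the mass `ξ(t)` up to the
relative error `δ`, and `u_ε(t)` is `χ(t)` up to the error `δ`. -/
structure ShadowWaveApproximation (f κ ua : ℝ → ℝ) (vs us Y : ℕ → ℝ) (ε C δ : ℝ) extends
    WaveHistory f κ ua vs us Y where
  /-- the initial half-width `x_ε` of the shadow wave `(l, r)` -/
  offset : ℕ → ℕ → ℝ
  /-- the inner density `v_ε(t)` of the shadow wave `(l, r)` -/
  vin : ℕ → ℕ → ℝ → ℝ
  /-- the inner velocity `u_ε(t)` of the shadow wave `(l, r)` -/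
  uin : ℕ → ℕ → ℝ → ℝ
  /-- the velocity `z_i(x,t)` in the vacuum between the states `i` and `i + 1` -/
  z : ℕ → ℝ → ℝ → ℝ
  /-- first component of `U^ε`, as a function of `x` and `t` -/
  v : ℝ → ℝ → ℝ
  /-- second component of `U^ε`, as a function of `x` and `t` -/
  u : ℝ → ℝ → ℝ
  offset_initial : ∀ l r, IsShadowWave death l r → frontBirth death l r = 0 → offset l r = 0
  offset_pos : ∀ l r, IsShadowWave death l r → 0 < frontBirth death l r → 0 < offset l r
  offset_le : ∀ l r, IsShadowWave death l r → 0 < frontBirth death l r → offset l r ≤ C * ε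
  vin_approx : ∀ l r, IsShadowWave death l r → ∀ t, 0 < t → IsFrontAt death l r t →
    |2 * (ε / 2 * (t - (frontBirth death l r).toReal) + offset l r) * vin l r t - ξ l r t| ≤
      δ * ξ l r t
  uin_approx : ∀ l r, IsShadowWave death l r → ∀ t, 0 < t → IsFrontAt death l r t →
    |uin l r t - χ l r t| ≤ δ
  /-- the velocity in a vacuum is continuous between the two contacts -/
  z_continuous : ∀ i, us i ≤ us (i + 1) → ContinuousOn (fun p : ℝ × ℝ => z i p.1 p.2)
    {p | 0 < p.2 ∧ contactPath f κ ua us Y (2 * i) p.2 ≤ p.1 ∧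
      p.1 ≤ contactPath f κ ua us Y (2 * i + 1) p.2}
  /-- it takes the velocities of the adjacent states at the contacts -/
  z_left : ∀ i, us i ≤ us (i + 1) → ∀ t, 0 < t →
    z i (contactPath f κ ua us Y (2 * i) t) t = relax κ ua (us i) t
  z_right : ∀ i, us i ≤ us (i + 1) → ∀ t, 0 < t →
    z i (contactPath f κ ua us Y (2 * i + 1) t) t = relax κ ua (us (i + 1)) t
  /-- and lies between these velocities -/
  z_mem : ∀ i, us i ≤ us (i + 1) → ∀ t, 0 < t →
    ∀ x ∈ Icc (contactPath f κ ua us Y (2 * i) t) (contactPath f κ ua us Y (2 * i + 1) t),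
    z i x t ∈ Icc (relax κ ua (us i) t) (relax κ ua (us (i + 1)) t)
  /-- In the strip of a shadow wave, `U^ε` is the inner state. Where strips overlap, just before an
  interaction, it is the inner state of one of them. -/
  value_inside : ∀ x t, 0 < t →
    (∃ l r, IsShadowWave death l r ∧ IsFrontAt death l r t ∧
      |x - c l r t| < ε / 2 * (t - (frontBirth death l r).toReal) + offset l r) →
    ∃ l r, IsShadowWave death l r ∧ IsFrontAt death l r t ∧
      |x - c l r t| < ε / 2 * (t - (frontBirth death l r).toReal) + offset l r ∧
      v x t = vin l r t ∧ u x t = uin l r t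
  /-- Outside all the strips, `U^ε` is the state of the medium in which the point lies. (On the
  lines which bound the media and the strips no value is prescribed.) -/
  value_outside : ∀ x t, 0 < t →
    (∀ l r, IsShadowWave death l r → IsFrontAt death l r t →
      ε / 2 * (t - (frontBirth death l r).toReal) + offset l r < |x - c l r t|) →
    ∀ m, ENNReal.ofReal t < death m →
    (∀ l, IsFrontAt death l m t → c l m t < x) → (∀ r, IsFrontAt death m r t → x < c m r t) →
    v x t = mediumDensity vs m ∧
      u x t = if Even m then mediumVelocity κ ua us m t else z (m / 2) x t

/-! ### Measures on the half-plane -/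

/-- The closed half-plane `ℝ × [0, ∞)` of points `(x, t)`, with the Lebesgue measure. -/
abbrev HalfPlane : Type := {p : ℝ × ℝ // 0 ≤ p.2}

noncomputable instance : MeasureSpace HalfPlane := Measure.Subtype.measureSpace

/-- A signed Radon measure, given by its Jordan decomposition. -/
structure SignedRadonMeasure (X : Type*) [TopologicalSpace X] [MeasurableSpace X] where
  pos : Measure X
  neg : Measure X
  locallyFinite_pos : IsLocallyFiniteMeasure pos
  locallyFinite_neg : IsLocallyFiniteMeasure neg
  regular_pos : pos.Regular
  regular_neg : neg.Regular
  mutuallySingular : pos ⟂ₘ neg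

/-- Weak* convergence of the measures `w n dx dt` to `μ`, tested with `C_c (ℝ × [0, ∞))`. -/
def WeakStarTendsto (w : ℕ → ℝ → ℝ → ℝ) (μ : SignedRadonMeasure HalfPlane) : Prop :=
  ∀ φ : HalfPlane → ℝ, Continuous φ → HasCompactSupport φ →
    Tendsto (fun n => ∫ p : HalfPlane, φ p * w n p.1.1 p.1.2) atTop
      (𝓝 ((∫ p, φ p ∂μ.pos) - ∫ p, φ p ∂μ.neg))

/-!
The theorem follows from bounds on the approximate solutions which are uniform in `ν`, together with
the weak* compactness of locally bounded sequences of measures. The bounds come from three facts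
about a single wave history. Each of them is proved by induction on the number of media that a wave
has swallowed: it is checked at the birth of the wave, where it is inherited from the incoming
waves, and then propagated along the life of the wave by the integrated equations.

* *Positive mass* (`WaveHistory.mass_pos`). An overcompressive wave gains mass from both sides.
* *Velocity and position* (`WaveHistory.velocity_mem_Icc`, `WaveHistory.path_mem_Icc`). A wave
  `(l, r)` has a velocity between the velocities of the contacts that bound the medium `r` on its
  left and the medium `l` on its right, as if nothing had been eliminated, and lies between these
  contacts. For the propagation, the product of the mass with the difference between `χ` and a
  solution `w` of the relaxation law satisfies a linear equation whose source is the mass gain times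
  the difference between the velocity of the swallowed state and `w`, which has a sign. At an
  interaction one needs in addition that waves which meet are ordered by decreasing velocities
  (`WaveHistory.frontVelocity_le_of_meet`). Hence all velocities are bounded by those of the relaxed
  data, and the part of a vacuum that is still present lies in the sector where its velocity is
  prescribed.
* *Conservation of mass* (`WaveHistory.mass_eq_massPotential_sub`). Each medium carries an affine
  potential that measures the initial mass to the left of a characteristic, and the mass of a wave
  is the jump of the potential across it. Summation over the waves left of a point telescopes, the
  remaining terms having a sign by the order of the waves, and bounds the total mass in a bounded
  interval by the initial mass in its domain of dependence (`WaveHistory.sum_mass_le`).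

Off countably many points, a time slice of the approximate solution takes values prescribed in the
strips and the media, which gives bounds for the velocity, the sign of the density for `δ < 1`, and
the mass of the density in an interval (`ShadowWaveApproximation.abs_u_le`,
`ShadowWaveApproximation.v_nonneg`, `ShadowWaveApproximation.lintegral_v_le`). Fubini's theorem
turns them into bounds on the half-plane, since the approximations are measurable. Finally a
subsequence is extracted along which the integrals of a countable dense set of test functions
converge, and the limit functional is represented by a measure according to the
Riesz–Markov–Kakutani theorem; for the signed component this is done for the positive and negative
parts, whose limits are subtracted (`exists_subseq_tendsto_integral_mul`).
-/


/-! ### Primitives and the relaxation law -/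

/-- The coefficients of the relaxation law `w' = κ (u_a - w)` are measurable, and bounded on bounded
time intervals. -/
structure RelaxationCoefficients (κ ua : ℝ → ℝ) : Prop where
  measurable_rate : Measurable κ
  bounded_rate : LocallyBoundedOnTimes κ
  measurable_target : Measurable ua
  bounded_target : LocallyBoundedOnTimes ua

lemma LocallyBoundedOnTimes.intervalIntegrable {g : ℝ → ℝ} (hg : LocallyBoundedOnTimes g)
    (hm : Measurable g) {a b : ℝ} (ha : 0 ≤ a) (hb : 0 ≤ b) : IntervalIntegrable g volume a b := by
  obtain ⟨M, hM⟩ := hg (max a b)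
  rw [intervalIntegrable_iff]
  refine Measure.integrableOn_of_bounded (M := M) (by simp) hm.aestronglyMeasurable ?_
  refine (ae_restrict_iff' measurableSet_uIoc).2 (ae_of_all _ fun x hx => ?_)
  rw [uIoc, mem_Ioc] at hx
  exact hM x ⟨(le_min ha hb).trans hx.1.le, hx.2⟩

lemma continuousOn_primitive_Ici {g : ℝ → ℝ}
    (hg : ∀ b, 0 ≤ b → IntervalIntegrable g volume 0 b) :
    ContinuousOn (fun t => ∫ s in (0 : ℝ)..t, g s) (Ici 0) := by
  intro t ht
  have ht' : (0 : ℝ) ≤ t := ht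
  have h := intervalIntegral.continuousOn_primitive_interval' (hg (t + 1) (by linarith))
    left_mem_uIcc
  rw [uIcc_of_le (by linarith)] at h
  refine (h t ⟨ht', by linarith⟩).mono_of_mem_nhdsWithin ?_
  rw [mem_nhdsWithin]
  exact ⟨Iio (t + 1), isOpen_Iio, by simp, fun x hx => ⟨hx.2, le_of_lt hx.1⟩⟩

/-- The product rule in integrated form. -/
lemma mul_sub_mul_eq_integral {F G p q : ℝ → ℝ} {a b : ℝ} (hab : a ≤ b)
    (hp : IntervalIntegrable p volume a b) (hq : IntervalIntegrable q volume a b)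
    (hF : ∀ t ∈ Icc a b, F t - F a = ∫ s in a..t, p s)
    (hG : ∀ t ∈ Icc a b, G t - G a = ∫ s in a..t, q s) :
    F b * G b - F a * G a = ∫ s in a..b, (p s * G s + F s * q s) := by
  have key : ∀ {H r : ℝ → ℝ}, IntervalIntegrable r volume a b →
      AbsolutelyContinuousOnInterval (fun t => H a + ∫ s in a..t, r s) a b ∧
      ∀ᵐ t, t ∈ uIcc a b → deriv (fun t => H a + ∫ s in a..t, r s) t = r t := by
    intro H r hr
    refine ⟨?_, ?_⟩
    · exact (LipschitzWith.const (H a)).lipschitzOnWith.absolutelyContinuousOnInterval.add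
        (hr.absolutelyContinuousOnInterval_intervalIntegral left_mem_uIcc)
    · filter_upwards [hr.ae_hasDerivAt_integral] with t ht htm
      exact ((ht htm a left_mem_uIcc).const_add (H a)).deriv
  obtain ⟨hF1, hF2⟩ := key (H := F) hp
  obtain ⟨hG1, hG2⟩ := key (H := G) hq
  have h := hF1.integral_deriv_mul_eq_sub hG1
  have e : ∀ {H r : ℝ → ℝ}, (∀ t ∈ Icc a b, H t - H a = ∫ s in a..t, r s) → ∀ t ∈ Icc a b,
      H a + ∫ s in a..t, r s = H t := fun hH t ht => by rw [← hH t ht]; ring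
  simp only [e hF b ⟨hab, le_rfl⟩, e hG b ⟨hab, le_rfl⟩, intervalIntegral.integral_same,
    add_zero] at h
  rw [← h]
  refine intervalIntegral.integral_congr_ae ?_
  filter_upwards [hF2, hG2] with t h1 h2 ht
  have ht' := uIoc_subset_uIcc ht
  have ht'' := ht'
  rw [uIcc_of_le hab] at ht''
  rw [h1 ht', h2 ht', e hF t ht'', e hG t ht'']

/-- The integrating factor `exp (∫₀ᵗ κ)` of the relaxation law. -/
noncomputable def relaxFactor (κ : ℝ → ℝ) (t : ℝ) : ℝ := Real.exp (∫ θ in (0 : ℝ)..t, κ θ)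

lemma relaxFactor_pos (κ : ℝ → ℝ) (t : ℝ) : 0 < relaxFactor κ t := Real.exp_pos _

namespace RelaxationCoefficients

variable {κ ua : ℝ → ℝ}

lemma intervalIntegrable_rate (hc : RelaxationCoefficients κ ua) {a b : ℝ} (ha : 0 ≤ a)
    (hb : 0 ≤ b) : IntervalIntegrable κ volume a b :=
  hc.bounded_rate.intervalIntegrable hc.measurable_rate ha hb

lemma continuousOn_relaxFactor (hc : RelaxationCoefficients κ ua) :
    ContinuousOn (relaxFactor κ) (Ici 0) :=
  Real.continuous_exp.comp_continuousOn
    (continuousOn_primitive_Ici fun _ hb => hc.intervalIntegrable_rate le_rfl hb)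

lemma intervalIntegrable_rate_mul_target (hc : RelaxationCoefficients κ ua) {a b : ℝ}
    (ha : 0 ≤ a) (hb : 0 ≤ b) : IntervalIntegrable (fun t => κ t * ua t) volume a b := by
  refine LocallyBoundedOnTimes.intervalIntegrable (fun T => ?_)
    (hc.measurable_rate.mul hc.measurable_target) ha hb
  obtain ⟨M, hM⟩ := hc.bounded_rate T
  obtain ⟨N, hN⟩ := hc.bounded_target T
  refine ⟨M * N, fun t ht => ?_⟩
  rw [Pi.mul_apply, abs_mul]
  exact mul_le_mul (hM t ht) (hN t ht) (abs_nonneg _) ((abs_nonneg _).trans (hM t ht))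

lemma continuousOn_uIcc {g : ℝ → ℝ} (hg : ContinuousOn g (Ici 0)) {a b : ℝ} (ha : 0 ≤ a)
    (hb : 0 ≤ b) : ContinuousOn g (uIcc a b) :=
  hg.mono fun _ hx => (le_min ha hb).trans hx.1

lemma intervalIntegrable_source (hc : RelaxationCoefficients κ ua) {a b : ℝ} (ha : 0 ≤ a)
    (hb : 0 ≤ b) : IntervalIntegrable (fun t => κ t * ua t * relaxFactor κ t) volume a b :=
  (hc.intervalIntegrable_rate_mul_target ha hb).mul_continuousOn
    (continuousOn_uIcc hc.continuousOn_relaxFactor ha hb)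

/-- The integrating factor `E` solves `E' = κ E`, in integrated form. As `κ` is only measurable, the
chain rule holds almost everywhere, and `E` is recovered from its derivative since it is
Lipschitz. -/
lemma relaxFactor_sub (hc : RelaxationCoefficients κ ua) {a b : ℝ} (ha : 0 ≤ a) (hab : a ≤ b) :
    relaxFactor κ b - relaxFactor κ a = ∫ s in a..b, κ s * relaxFactor κ s := by
  have hb := ha.trans hab
  have hI : IntervalIntegrable κ volume 0 b := hc.intervalIntegrable_rate le_rfl hb
  obtain ⟨M, hM⟩ := hc.bounded_rate b
  have hM0 : 0 ≤ M := (abs_nonneg _).trans (hM b ⟨hb, le_rfl⟩)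
  have hlip : LipschitzOnWith M.toNNReal (fun t => ∫ θ in (0 : ℝ)..t, κ θ) (Icc 0 b) := by
    refine LipschitzOnWith.of_dist_le_mul fun x hx y hy => ?_
    rw [Real.dist_eq, Real.dist_eq, intervalIntegral.integral_interval_sub_left
      (hc.intervalIntegrable_rate le_rfl hx.1) (hc.intervalIntegrable_rate le_rfl hy.1),
      ← Real.norm_eq_abs, Real.coe_toNNReal _ hM0]
    refine intervalIntegral.norm_integral_le_of_norm_le_const fun t ht => ?_
    exact hM t ⟨(le_min hy.1 hx.1).trans ht.1.le, ht.2.trans (max_le hy.2 hx.2)⟩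
  have hcomp : IsCompact ((fun t => ∫ θ in (0 : ℝ)..t, κ θ) '' Icc 0 b) :=
    isCompact_Icc.image_of_continuousOn hlip.continuousOn
  obtain ⟨c, d, hcd⟩ : ∃ c d, (fun t => ∫ θ in (0 : ℝ)..t, κ θ) '' Icc 0 b ⊆ Icc c d := by
    obtain ⟨r, hr⟩ := hcomp.isBounded.subset_closedBall 0
    exact ⟨_, _, hr.trans (Real.closedBall_eq_Icc).subset⟩
  obtain ⟨L, hL⟩ := (Real.contDiff_exp (n := 1)).contDiffOn.exists_lipschitzOnWith (by decide)
    (convex_Icc c d) isCompact_Icc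
  have hE : LipschitzOnWith (L * M.toNNReal) (relaxFactor κ) (Icc 0 b) :=
    hL.comp hlip fun t ht => hcd (mem_image_of_mem _ ht)
  have hAC : AbsolutelyContinuousOnInterval (relaxFactor κ) a b := by
    refine (hE.mono ?_).absolutelyContinuousOnInterval
    rw [uIcc_of_le hab]
    exact Icc_subset_Icc ha le_rfl
  rw [← hAC.integral_deriv_eq_sub]
  refine intervalIntegral.integral_congr_ae ?_
  filter_upwards [hI.ae_hasDerivAt_integral] with t ht htm
  rw [uIoc_of_le hab] at htm
  have := (ht (by rw [uIcc_of_le hb]; exact ⟨ha.trans htm.1.le, htm.2⟩) 0 left_mem_uIcc).exp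
  rw [mul_comm]
  exact this.deriv

lemma relax_mul_relaxFactor (κ ua : ℝ → ℝ) (w t : ℝ) : relax κ ua w t * relaxFactor κ t =
    (∫ θ in (0 : ℝ)..t, κ θ * ua θ * relaxFactor κ θ) + w := by
  unfold relax relaxFactor
  rw [mul_right_comm, ← Real.exp_add, neg_add_cancel, Real.exp_zero, one_mul]

lemma continuousOn_relax (hc : RelaxationCoefficients κ ua) (w : ℝ) :
    ContinuousOn (relax κ ua w) (Ici 0) := by
  unfold relax
  refine ContinuousOn.mul (Real.continuous_exp.comp_continuousOn (continuousOn_primitive_Ici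
    fun _ hb => hc.intervalIntegrable_rate le_rfl hb).neg) (ContinuousOn.add ?_ continuousOn_const)
  exact continuousOn_primitive_Ici fun _ hb => hc.intervalIntegrable_source le_rfl hb

end RelaxationCoefficients

lemma relax_le_relax {κ ua : ℝ → ℝ} {w w' t : ℝ} : relax κ ua w t ≤ relax κ ua w' t ↔ w ≤ w' := by
  unfold relax
  rw [mul_le_mul_iff_right₀ (Real.exp_pos _)]
  simp

/-- Relaxation keeps bounded data bounded on bounded time intervals. -/
lemma RelaxationCoefficients.exists_abs_relax_le {κ ua : ℝ → ℝ} (hc : RelaxationCoefficients κ ua)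
    (M T : ℝ) : ∃ B, ∀ w, |w| ≤ M → ∀ t ∈ Icc 0 T, |relax κ ua w t| ≤ B := by
  obtain ⟨B₁, h₁⟩ := isCompact_Icc.exists_bound_of_continuousOn
    ((hc.continuousOn_relax M).mono (Icc_subset_Ici_self : Icc 0 T ⊆ _))
  obtain ⟨B₂, h₂⟩ := isCompact_Icc.exists_bound_of_continuousOn
    ((hc.continuousOn_relax (-M)).mono (Icc_subset_Ici_self : Icc 0 T ⊆ _))
  refine ⟨max B₁ B₂, fun w hw t ht => ?_⟩
  rw [abs_le] at hw
  have e₁ := (le_abs_self _).trans (h₁ t ht)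
  have e₂ := (neg_abs_le _).trans' (neg_le_neg (h₂ t ht))
  have e₃ := relax_le_relax (κ := κ) (ua := ua) (t := t) |>.2 hw.1
  have e₄ := relax_le_relax (κ := κ) (ua := ua) (t := t) |>.2 hw.2
  rw [abs_le]
  exact ⟨by linarith [le_max_right B₁ B₂], by linarith [le_max_left B₁ B₂]⟩

/-- Comparison of a momentum `m` with the momentum of the mass `ξ` moving with a velocity subject to
the relaxation law: if `ξ' = q` and `m' = g - κ (m - u_a ξ)`, then `(m - ξ w)' + κ (m - ξ w) =
g - q w` for each solution `w` of `w' = κ (u_a - w)`. -/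
lemma RelaxationCoefficients.excess_momentum_eq {κ ua : ℝ → ℝ} (hc : RelaxationCoefficients κ ua)
    {m ξ g q : ℝ → ℝ} {a b : ℝ} (ha : 0 ≤ a) (hab : a ≤ b)
    (hg : ContinuousOn g (Icc a b)) (hq : ContinuousOn q (Icc a b))
    (hmc : ContinuousOn m (Icc a b)) (hξc : ContinuousOn ξ (Icc a b))
    (hm : ∀ t ∈ Icc a b, m t - m a = ∫ s in a..t, (g s - κ s * (m s - ua s * ξ s)))
    (hξ : ∀ t ∈ Icc a b, ξ t - ξ a = ∫ s in a..t, q s) (w : ℝ) :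
    (m b - ξ b * relax κ ua w b) * relaxFactor κ b -
      (m a - ξ a * relax κ ua w a) * relaxFactor κ a =
    ∫ s in a..b, relaxFactor κ s * (g s - q s * relax κ ua w s) := by
  have hb := ha.trans hab
  have hsub : Icc a b ⊆ Ici 0 := fun x hx => ha.trans hx.1
  rw [← uIcc_of_le hab] at hg hq hmc hξc
  have hEc : ContinuousOn (relaxFactor κ) (uIcc a b) := by
    rw [uIcc_of_le hab]; exact hc.continuousOn_relaxFactor.mono hsub
  have hwc : ContinuousOn (relax κ ua w) (uIcc a b) := by
    rw [uIcc_of_le hab]; exact (hc.continuousOn_relax w).mono hsub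
  have hκ := hc.intervalIntegrable_rate ha hb
  have hκu := hc.intervalIntegrable_rate_mul_target ha hb
  have hB := hc.intervalIntegrable_source ha hb
  have hp : IntervalIntegrable (fun s => g s - κ s * (m s - ua s * ξ s)) volume a b := by
    refine (hg.intervalIntegrable.sub ((hκ.mul_continuousOn hmc).sub
      (hκu.mul_continuousOn hξc))).congr ?_
    exact fun s _ => by ring
  have e₁ := mul_sub_mul_eq_integral hab hp (hκ.mul_continuousOn hEc) hm
    (fun t ht => hc.relaxFactor_sub ha ht.1)
  have e₂ := mul_sub_mul_eq_integral (G := fun t => relax κ ua w t * relaxFactor κ t) hab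
    hq.intervalIntegrable hB hξ (fun t ht => by
      simp only [relax_mul_relaxFactor]
      rw [add_sub_add_right_eq_sub, intervalIntegral.integral_interval_sub_left
        (hc.intervalIntegrable_source le_rfl (ha.trans ht.1))
        (hc.intervalIntegrable_source le_rfl ha)])
  have e₃ := congrArg₂ (· - ·) e₁ e₂
  rw [← intervalIntegral.integral_sub] at e₃
  · refine Eq.trans (by ring) (e₃.trans ?_)
    exact intervalIntegral.integral_congr fun s _ => by ring
  · exact (hp.mul_continuousOn hEc).add ((hκ.mul_continuousOn hEc).continuousOn_mul hmc)
  · exact (hq.intervalIntegrable.mul_continuousOn (hwc.mul hEc)).add (hB.continuousOn_mul hξc)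

/-! ### Consecutive media -/

/-- `l < r` are consecutive among the numbers with the property `A`. -/
def IsConsecutive (A : ℕ → Prop) (l r : ℕ) : Prop :=
  l < r ∧ A l ∧ A r ∧ ∀ m ∈ Finset.Ioo l r, ¬ A m

namespace IsConsecutive

variable {A : ℕ → Prop} {l m r : ℕ}

lemma exists_right (hl : A l) (hr : A r) (h : l < r) : ∃ b, b ≤ r ∧ IsConsecutive A l b := by
  classical
  have hex : ∃ b, l < b ∧ A b := ⟨r, h, hr⟩
  refine ⟨Nat.find hex, Nat.find_min' hex ⟨h, hr⟩, (Nat.find_spec hex).1, hl,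
    (Nat.find_spec hex).2, fun m hm hA => ?_⟩
  rw [Finset.mem_Ioo] at hm
  exact Nat.find_min hex hm.2 ⟨hm.1, hA⟩

lemma exists_left (hl : A l) (hr : A r) (h : l < r) : ∃ a, l ≤ a ∧ IsConsecutive A a r := by
  induction hd : r - l using Nat.strong_induction_on generalizing l with
  | _ d ih =>
    by_cases hex : ∃ m ∈ Finset.Ioo l r, A m
    · obtain ⟨m, hm, hA⟩ := hex
      rw [Finset.mem_Ioo] at hm
      obtain ⟨a, ha, hc⟩ := ih (r - m) (by omega) hA hm.2 rfl
      exact ⟨a, by omega, hc⟩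
    · push Not at hex
      exact ⟨l, le_rfl, h, hl, hr, hex⟩

lemma le_left (h : IsConsecutive A l r) (hm : A m) (hmr : m < r) : m ≤ l := by
  by_contra! hlm
  exact h.2.2.2 m (Finset.mem_Ioo.2 ⟨hlm, hmr⟩) hm

lemma left_unique {l' : ℕ} (h : IsConsecutive A l r) (h' : IsConsecutive A l' r) : l = l' :=
  le_antisymm (h'.le_left h.2.1 h.1) (h.le_left h'.2.1 h'.1)

end IsConsecutive

open Classical in
/-- The pairs of consecutive numbers with the property `A` in `[l, r]`. -/
noncomputable def consecutivePairs (A : ℕ → Prop) (l r : ℕ) : Finset (ℕ × ℕ) :=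
  ((Finset.Icc l r) ×ˢ (Finset.Icc l r)).filter fun p => IsConsecutive A p.1 p.2

lemma mem_consecutivePairs {A : ℕ → Prop} {l r : ℕ} {p : ℕ × ℕ} :
    p ∈ consecutivePairs A l r ↔ l ≤ p.1 ∧ p.2 ≤ r ∧ IsConsecutive A p.1 p.2 := by
  classical
  unfold consecutivePairs
  rw [Finset.mem_filter, Finset.mem_product, Finset.mem_Icc, Finset.mem_Icc]
  constructor
  · rintro ⟨⟨h1, h2⟩, h3⟩
    exact ⟨h1.1, h2.2, h3⟩
  · rintro ⟨h1, h2, h3⟩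
    have := h3.1
    exact ⟨⟨⟨h1, by omega⟩, ⟨by omega, h2⟩⟩, h3⟩

lemma sum_consecutivePairs {A : ℕ → Prop} {l a r : ℕ} (hla : l ≤ a) (h : IsConsecutive A a r)
    (F : ℕ × ℕ → ℝ) :
    ∑ p ∈ consecutivePairs A l r, F p = F (a, r) + ∑ p ∈ consecutivePairs A l a, F p := by
  classical
  have har := h.1
  rw [← Finset.sum_insert]
  · congr 1
    ext ⟨b, d⟩
    simp only [Finset.mem_insert, mem_consecutivePairs, Prod.mk.injEq]
    constructor
    · rintro ⟨h1, h2, h3⟩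
      rcases h2.lt_or_eq with hd | rfl
      · exact .inr ⟨h1, h.le_left h3.2.2.1 hd, h3⟩
      · exact .inl ⟨h3.left_unique h, rfl⟩
    · rintro (⟨rfl, rfl⟩ | ⟨h1, h2, h3⟩)
      · exact ⟨hla, le_rfl, h⟩
      · exact ⟨h1, by omega, h3⟩
  · rw [mem_consecutivePairs]
    rintro ⟨-, h2, -⟩
    exact absurd h2 (by simpa using har)

lemma consecutivePairs_self (A : ℕ → Prop) (l : ℕ) : consecutivePairs A l l = ∅ := by
  refine Finset.eq_empty_of_forall_notMem fun p hp => ?_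
  rw [mem_consecutivePairs] at hp
  have := hp.2.2.1
  omega

/-- Increments over the pairs of consecutive numbers telescope. -/
lemma sum_consecutivePairs_sub {A : ℕ → Prop} {l r : ℕ} (hl : A l) (hr : A r) (h : l ≤ r)
    (g : ℕ → ℝ) : ∑ p ∈ consecutivePairs A l r, (g p.2 - g p.1) = g r - g l := by
  induction r using Nat.strong_induction_on with
  | _ r ih =>
    rcases h.eq_or_lt with rfl | hlt
    · simp [consecutivePairs_self]
    · obtain ⟨a, ha, hc⟩ := IsConsecutive.exists_left hl hr hlt
      rw [sum_consecutivePairs ha hc, ih a hc.1 hc.2.1 ha]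
      ring

/-! ### Fronts and their life spans -/

section Fronts

variable {death : ℕ → ℝ≥0∞} {l r : ℕ} {s t : ℝ}

lemma isFrontAt_iff (ht : 0 ≤ t) :
    IsFrontAt death l r t ↔ IsConsecutive (fun m => ENNReal.ofReal t < death m) l r := by
  unfold IsFrontAt IsConsecutive frontBirth
  rw [Finset.sup_le_iff]
  simp only [not_lt]
  tauto

lemma isFrontBefore_iff (ht : 0 < t) :
    IsFrontBefore death l r t ↔ IsConsecutive (fun m => ENNReal.ofReal t ≤ death m) l r := by
  unfold IsFrontBefore IsConsecutive frontBirth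
  rw [Finset.sup_lt_iff (by simpa using ht)]
  simp only [not_le]
  tauto

lemma incoming_eq (ht : 0 < t) :
    incoming death l r t = consecutivePairs (fun m => ENNReal.ofReal t ≤ death m) l r := by
  classical
  unfold incoming consecutivePairs
  exact Finset.filter_congr fun p _ => isFrontBefore_iff ht

lemma frontBirth_contact (k : ℕ) : frontBirth death k (k + 1) = 0 := by
  have : Finset.Ioo k (k + 1) = ∅ := by
    ext m; simp only [Finset.mem_Ioo, Finset.notMem_empty, iff_false]; omega
  simp [frontBirth, this]

/-- `(l, r)` is a front that occurs: a contact discontinuity or a shadow wave. -/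
def IsWave (death : ℕ → ℝ≥0∞) (l r : ℕ) : Prop := r = l + 1 ∨ IsShadowWave death l r

lemma IsFrontAt.isWave (h : IsFrontAt death l r t) : IsWave death l r := by
  obtain ⟨h1, -, h3, h4, h5⟩ := h
  rcases (Nat.succ_le_of_lt h1).eq_or_lt with h | h
  · exact .inl h.symm
  · exact .inr ⟨h, h3.trans_lt h4, h3.trans_lt h5⟩

lemma IsFrontBefore.isWave (h : IsFrontBefore death l r t) : IsWave death l r := by
  obtain ⟨h1, -, h3, h4, h5⟩ := h
  rcases (Nat.succ_le_of_lt h1).eq_or_lt with h | h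
  · exact .inl h.symm
  · exact .inr ⟨h, h3.trans_le h4, h3.trans_le h5⟩

lemma IsWave.frontBirth_ne_top (h : IsWave death l r) : frontBirth death l r ≠ ⊤ := by
  rcases h with rfl | h
  · simp [frontBirth_contact]
  · exact h.2.1.ne_top

lemma IsWave.ofReal_birth (h : IsWave death l r) :
    ENNReal.ofReal (frontBirth death l r).toReal = frontBirth death l r :=
  ENNReal.ofReal_toReal h.frontBirth_ne_top

lemma birth_le_of_mem_lifeSpan (ht : t ∈ lifeSpan death l r) :
    (frontBirth death l r).toReal ≤ t :=
  ENNReal.toReal_le_of_le_ofReal ht.1 ht.2.1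

lemma IsWave.birth_mem (h : IsWave death l r) :
    (frontBirth death l r).toReal ∈ lifeSpan death l r := by
  refine ⟨ENNReal.toReal_nonneg, ?_⟩
  rw [h.ofReal_birth]
  rcases h with rfl | h
  · simp [frontBirth_contact]
  · exact ⟨le_rfl, h.2.1.le, h.2.2.le⟩

lemma IsWave.birth_lt (h : IsWave death l r) (ht : (frontBirth death l r).toReal < t) :
    frontBirth death l r < ENNReal.ofReal t := by
  rw [← h.ofReal_birth]
  exact (ENNReal.ofReal_lt_ofReal_iff (ENNReal.toReal_nonneg.trans_lt ht)).2 ht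

lemma Icc_subset_lifeSpan (hs : s ∈ lifeSpan death l r) (ht : t ∈ lifeSpan death l r) :
    Icc s t ⊆ lifeSpan death l r := fun _ hx =>
  ⟨hs.1.trans hx.1, hs.2.1.trans (ENNReal.ofReal_le_ofReal hx.1),
    (ENNReal.ofReal_le_ofReal hx.2).trans ht.2.2.1, (ENNReal.ofReal_le_ofReal hx.2).trans ht.2.2.2⟩

lemma IsFrontAt.mem_lifeSpan (h : IsFrontAt death l r t) : t ∈ lifeSpan death l r :=
  ⟨h.2.1, h.2.2.1, h.2.2.2.1.le, h.2.2.2.2.le⟩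

lemma IsFrontBefore.mem_lifeSpan (h : IsFrontBefore death l r t) : t ∈ lifeSpan death l r :=
  ⟨h.2.1.le, h.2.2.1.le, h.2.2.2⟩

lemma IsFrontBefore.birth_lt (h : IsFrontBefore death l r t) :
    (frontBirth death l r).toReal < t := by
  have h3 := h.2.2.1
  rw [← h.isWave.ofReal_birth] at h3
  exact (ENNReal.ofReal_lt_ofReal_iff h.2.1).1 h3

lemma IsWave.lt (h : IsWave death l r) : l < r := by
  rcases h with rfl | h
  · exact l.lt_succ_self
  · have := h.1; omega

lemma IsWave.isFrontAt (h : IsWave death l r) (ht : t ∈ lifeSpan death l r)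
    (hs : (frontBirth death l r).toReal ≤ s) (hst : s < t) : IsFrontAt death l r s := by
  have hs0 : 0 ≤ s := ENNReal.toReal_nonneg.trans hs
  have hlt : ENNReal.ofReal s < ENNReal.ofReal t :=
    (ENNReal.ofReal_lt_ofReal_iff (hs0.trans_lt hst)).2 hst
  refine ⟨h.lt, hs0, ?_, hlt.trans_le ht.2.2.1, hlt.trans_le ht.2.2.2⟩
  rw [← h.ofReal_birth]
  exact ENNReal.ofReal_le_ofReal hs

variable {T : ℝ}

lemma ofReal_le_death_left (h : IsShadowWave death l r)
    (hT : frontBirth death l r = ENNReal.ofReal T) : ENNReal.ofReal T ≤ death l :=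
  hT ▸ h.2.1.le

lemma ofReal_le_death_right (h : IsShadowWave death l r)
    (hT : frontBirth death l r = ENNReal.ofReal T) : ENNReal.ofReal T ≤ death r :=
  hT ▸ h.2.2.le

/-- A wave that takes part in the interaction producing the shadow wave `(l, r)`. -/
lemma mem_incoming {p : ℕ × ℕ} (hT0 : 0 < T) : p ∈ incoming death l r T ↔
    l ≤ p.1 ∧ p.2 ≤ r ∧ IsFrontBefore death p.1 p.2 T := by
  rw [incoming_eq hT0, mem_consecutivePairs, isFrontBefore_iff hT0]

lemma width_lt_of_mem_incoming {p : ℕ × ℕ} (hT0 : 0 < T)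
    (hT : frontBirth death l r = ENNReal.ofReal T) (hp : p ∈ incoming death l r T) :
    p.2 - p.1 < r - l := by
  obtain ⟨h1, h2, h3⟩ := (mem_incoming hT0).1 hp
  have := h3.1
  by_contra! hge
  have e1 : p.1 = l := by omega
  have e2 : p.2 = r := by omega
  have := h3.2.2.1
  rw [e1, e2, hT] at this
  exact this.false

lemma exists_first_incoming (h : IsShadowWave death l r) (hT0 : 0 < T)
    (hT : frontBirth death l r = ENNReal.ofReal T) : ∃ b, (l, b) ∈ incoming death l r T := by
  obtain ⟨b, hb, hc⟩ := IsConsecutive.exists_right (A := fun m => ENNReal.ofReal T ≤ death m)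
    (ofReal_le_death_left h hT) (ofReal_le_death_right h hT) (by have := h.1; omega)
  exact ⟨b, by rw [incoming_eq hT0, mem_consecutivePairs]; exact ⟨le_rfl, hb, hc⟩⟩

lemma exists_last_incoming (h : IsShadowWave death l r) (hT0 : 0 < T)
    (hT : frontBirth death l r = ENNReal.ofReal T) : ∃ a, (a, r) ∈ incoming death l r T := by
  obtain ⟨a, ha, hc⟩ := IsConsecutive.exists_left (A := fun m => ENNReal.ofReal T ≤ death m)
    (ofReal_le_death_left h hT) (ofReal_le_death_right h hT) (by have := h.1; omega)
  exact ⟨a, by rw [incoming_eq hT0, mem_consecutivePairs]; exact ⟨ha, le_rfl, hc⟩⟩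

lemma exists_next_incoming (h : IsShadowWave death l r) (hT0 : 0 < T)
    (hT : frontBirth death l r = ENNReal.ofReal T) {p : ℕ × ℕ} (hp : p ∈ incoming death l r T)
    (hpr : p.2 < r) : ∃ d, (p.2, d) ∈ incoming death l r T := by
  rw [incoming_eq hT0, mem_consecutivePairs] at hp
  have := hp.2.2.1
  obtain ⟨b, hb, hc⟩ := IsConsecutive.exists_right (A := fun m => ENNReal.ofReal T ≤ death m)
    hp.2.2.2.2.1 (ofReal_le_death_right h hT) hpr
  exact ⟨b, by rw [incoming_eq hT0, mem_consecutivePairs]; exact ⟨by simp; omega, hb, hc⟩⟩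

lemma exists_previous_incoming (h : IsShadowWave death l r) (hT0 : 0 < T)
    (hT : frontBirth death l r = ENNReal.ofReal T) {p : ℕ × ℕ} (hp : p ∈ incoming death l r T)
    (hpl : l < p.1) : ∃ a, (a, p.1) ∈ incoming death l r T := by
  rw [incoming_eq hT0, mem_consecutivePairs] at hp
  have := hp.2.2.1
  obtain ⟨a, ha, hc⟩ := IsConsecutive.exists_left (A := fun m => ENNReal.ofReal T ≤ death m)
    (ofReal_le_death_left h hT) hp.2.2.2.1 hpl
  exact ⟨a, by rw [incoming_eq hT0, mem_consecutivePairs]; exact ⟨ha, by simp; omega, hc⟩⟩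

end Fronts

/-- A weak inequality between continuous functions extends to the ends of an interval. -/
lemma le_on_Icc_of_le_on_Ioo {F G : ℝ → ℝ} {a b : ℝ} (hab : a < b) (hF : ContinuousOn F (Icc a b))
    (hG : ContinuousOn G (Icc a b)) (h : ∀ x ∈ Ioo a b, F x ≤ G x) :
    ∀ x ∈ Icc a b, F x ≤ G x := by
  intro x hx
  refine ContinuousWithinAt.closure_le (s := Ioo a b) ?_ ((hF x hx).mono Ioo_subset_Icc_self)
    ((hG x hx).mono Ioo_subset_Icc_self) h
  rwa [closure_Ioo hab.ne]

/-! ### Mass of a shadow wave -/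

namespace WaveHistory

variable {f κ ua : ℝ → ℝ} {vs us Y : ℕ → ℝ} (H : WaveHistory f κ ua vs us Y)
  {l m r : ℕ} {s t T : ℝ}

/-- The velocity of the front `(l, r)`: that of the adjacent state for a contact discontinuity, and
`χ` for a shadow wave. The front moves with the speed `f` of this velocity. -/
noncomputable def frontVelocity (l r : ℕ) (t : ℝ) : ℝ :=
  if r = l + 1 then relax κ ua (us (r / 2)) t else H.χ l r t

lemma frontVelocity_contact (k : ℕ) (t : ℝ) :
    H.frontVelocity k (k + 1) t = relax κ ua (us ((k + 1) / 2)) t := if_pos rfl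

lemma frontVelocity_shadow (h : IsShadowWave H.death l r) :
    H.frontVelocity l r = H.χ l r := by
  funext t
  exact if_neg (by have := h.1; omega)

/-- A shadow wave born at time `0` joins neighbouring states with a decreasing velocity. -/
lemma exists_eq_of_birth_eq_zero (h : IsShadowWave H.death l r)
    (h0 : frontBirth H.death l r = 0) : ∃ i, l = 2 * i ∧ r = 2 * i + 2 ∧ us (i + 1) < us i := by
  have hz : ∀ m, l < m → m < r → H.death m = 0 := fun m h1 h2 => by
    have := Finset.le_sup (f := H.death) (Finset.mem_Ioo.2 ⟨h1, h2⟩)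
    exact le_antisymm (this.trans h0.le) zero_le
  have hlr := h.1
  have hodd : ∀ m, l < m → m < r → m % 2 = 1 := fun m h1 h2 => by
    by_contra hne
    have := H.death_even (m / 2)
    rw [show 2 * (m / 2) = m by omega, hz m h1 h2] at this
    exact this.false
  have h1 := hodd (l + 1) (by omega) (by omega)
  have hr : r = l + 2 := by
    by_contra hne
    have := hodd (l + 2) (by omega) (by omega)
    omega
  refine ⟨l / 2, by omega, by omega, ?_⟩
  by_contra! hle
  have := H.death_odd_pos _ hle
  rw [show 2 * (l / 2) + 1 = l + 1 by omega, hz (l + 1) (by omega) (by omega)] at this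
  exact this.false

lemma mediumDensity_nonneg (hvs : ∀ i, 0 < vs i) (m : ℕ) : 0 ≤ mediumDensity vs m := by
  unfold mediumDensity
  split_ifs
  exacts [(hvs _).le, le_rfl]

/-- The rate at which the shadow wave `(l, r)` gains mass from the medium on its left. -/
noncomputable def leftRate (l r : ℕ) (t : ℝ) : ℝ :=
  mediumDensity vs l * (f (mediumVelocity κ ua us l t) - f (H.χ l r t))

/-- The rate at which the shadow wave `(l, r)` gains mass from the medium on its right. -/
noncomputable def rightRate (l r : ℕ) (t : ℝ) : ℝ :=
  mediumDensity vs r * (f (H.χ l r t) - f (mediumVelocity κ ua us r t))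

lemma leftRate_nonneg (hvs : ∀ i, 0 < vs i) (h : IsShadowWave H.death l r)
    (hb : (frontBirth H.death l r).toReal < t) (ht : IsFrontAt H.death l r t) :
    0 ≤ H.leftRate l r t := by
  by_cases hl : Even l
  · refine mul_nonneg (mediumDensity_nonneg hvs l) (sub_nonneg.2 ?_)
    exact (H.admissible_left l r h hl t (IsWave.birth_lt (.inr h) hb) ht).le
  · simp [leftRate, mediumDensity, hl]

lemma rightRate_nonneg (hvs : ∀ i, 0 < vs i) (h : IsShadowWave H.death l r)
    (hb : (frontBirth H.death l r).toReal < t) (ht : IsFrontAt H.death l r t) :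
    0 ≤ H.rightRate l r t := by
  by_cases hr : Even r
  · refine mul_nonneg (mediumDensity_nonneg hvs r) (sub_nonneg.2 ?_)
    exact (H.admissible_right l r h hr t (IsWave.birth_lt (.inr h) hb) ht).le
  · simp [rightRate, mediumDensity, hr]

lemma leftRate_pos (hvs : ∀ i, 0 < vs i) (h : IsShadowWave H.death l r) (hl : Even l)
    (hb : (frontBirth H.death l r).toReal < t) (ht : IsFrontAt H.death l r t) :
    0 < H.leftRate l r t := by
  refine mul_pos ?_ (sub_pos.2 (H.admissible_left l r h hl t (IsWave.birth_lt (.inr h) hb) ht))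
  rw [mediumDensity, if_pos hl]
  exact hvs _

lemma continuousOn_χ (h : IsShadowWave H.death l r)
    (hs : (frontBirth H.death l r).toReal < s) (hsL : s ∈ lifeSpan H.death l r)
    (ht : t ∈ lifeSpan H.death l r) : ContinuousOn (H.χ l r) (Icc s t) :=
  (H.continuous_velocity l r h).mono fun _ hx =>
    ⟨Icc_subset_lifeSpan hsL ht hx, IsWave.birth_lt (.inr h) (hs.trans_le hx.1)⟩

lemma continuousOn_mediumVelocity (hc : RelaxationCoefficients κ ua) (hs : 0 ≤ s) (m : ℕ) :
    ContinuousOn (mediumVelocity κ ua us m) (Icc s t) :=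
  (hc.continuousOn_relax _).mono fun _ hx => hs.trans hx.1

lemma continuousOn_leftRate (hc : RelaxationCoefficients κ ua) (hf : Continuous f)
    (h : IsShadowWave H.death l r)
    (hs : (frontBirth H.death l r).toReal < s) (hsL : s ∈ lifeSpan H.death l r)
    (ht : t ∈ lifeSpan H.death l r) : ContinuousOn (H.leftRate l r) (Icc s t) :=
  continuousOn_const.mul ((hf.comp_continuousOn (continuousOn_mediumVelocity hc hsL.1 l)).sub
    (hf.comp_continuousOn (H.continuousOn_χ h hs hsL ht)))

lemma continuousOn_rightRate (hc : RelaxationCoefficients κ ua) (hf : Continuous f)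
    (h : IsShadowWave H.death l r)
    (hs : (frontBirth H.death l r).toReal < s) (hsL : s ∈ lifeSpan H.death l r)
    (ht : t ∈ lifeSpan H.death l r) : ContinuousOn (H.rightRate l r) (Icc s t) :=
  continuousOn_const.mul ((hf.comp_continuousOn (H.continuousOn_χ h hs hsL ht)).sub
    (hf.comp_continuousOn (continuousOn_mediumVelocity hc hsL.1 r)))

lemma mass_sub (h : IsShadowWave H.death l r)
    (hs : (frontBirth H.death l r).toReal < s) (hsL : s ∈ lifeSpan H.death l r)
    (ht : t ∈ lifeSpan H.death l r) (hst : s ≤ t) :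
    H.ξ l r t - H.ξ l r s = ∫ τ in s..t, (H.rightRate l r τ + H.leftRate l r τ) := by
  rw [H.mass_eq l r h s hsL t ht (IsWave.birth_lt (.inr h) hs) hst]
  refine intervalIntegral.integral_congr fun τ _ => ?_
  simp only [rightRate, leftRate]
  ring

/-- Increments of continuous functions that compare after the birth of a wave also compare from the
birth on. The equations of a shadow wave are available after its birth only, where `χ` is known to
be continuous. -/
lemma le_of_le_after_birth {F G : ℝ → ℝ} (h : IsWave H.death l r)
    (hF : ContinuousOn F (lifeSpan H.death l r)) (hG : ContinuousOn G (lifeSpan H.death l r))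
    (hFG : ∀ s ∈ lifeSpan H.death l r, ∀ t ∈ lifeSpan H.death l r,
      (frontBirth H.death l r).toReal < s → s < t → F t - F s ≤ G t - G s)
    (ht : t ∈ lifeSpan H.death l r) :
    F t - F (frontBirth H.death l r).toReal ≤ G t - G (frontBirth H.death l r).toReal := by
  rcases (birth_le_of_mem_lifeSpan ht).eq_or_lt with hT | hT
  · rw [hT, sub_self, sub_self]
  have hsub := Icc_subset_lifeSpan h.birth_mem ht
  have := le_on_Icc_of_le_on_Ioo (F := fun s => F t - F s) (G := fun s => G t - G s) hT
    (continuousOn_const.sub (hF.mono hsub)) (continuousOn_const.sub (hG.mono hsub))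
    (fun s hs => hFG s (hsub (Ioo_subset_Icc_self hs)) t ht hs.1 hs.2)
  exact this _ ⟨le_rfl, hT.le⟩

/-- Overcompressive shadow waves gain mass. -/
lemma mass_birth_le (hc : RelaxationCoefficients κ ua) (hf : Continuous f) (hvs : ∀ i, 0 < vs i)
    (h : IsShadowWave H.death l r) (ht : t ∈ lifeSpan H.death l r) :
    H.ξ l r (frontBirth H.death l r).toReal ≤ H.ξ l r t := by
  have := H.le_of_le_after_birth (F := fun _ => (0 : ℝ)) (G := H.ξ l r) (.inr h)
    continuousOn_const (H.continuous_mass l r h) (fun s hs t ht hb hst => ?_) ht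
  · simpa using this
  · rw [H.mass_sub h hb hs ht hst.le, sub_self]
    have hI := ((H.continuousOn_rightRate hc hf h hb hs ht).add
      (H.continuousOn_leftRate hc hf h hb hs ht))
    rw [← intervalIntegral.integral_zero (a := s) (b := t) (μ := volume) (E := ℝ)]
    refine intervalIntegral.integral_mono_on_of_le_Ioo hst.le (by simp)
      (hI.intervalIntegrable_of_Icc hst.le) fun τ hτ => ?_
    have hat := IsWave.isFrontAt (.inr h) ht (hb.trans hτ.1).le hτ.2
    exact add_nonneg (H.rightRate_nonneg hvs h (hb.trans hτ.1) hat)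
      (H.leftRate_nonneg hvs h (hb.trans hτ.1) hat)

/-- Shadow waves have a positive mass at positive times. One born at time `0` separates two states
and gains mass at once; any other one contains an older shadow wave. -/
theorem mass_pos (hc : RelaxationCoefficients κ ua) (hf : Continuous f) (hvs : ∀ i, 0 < vs i)
    (h : IsShadowWave H.death l r) (ht : t ∈ lifeSpan H.death l r) (ht0 : 0 < t) :
    0 < H.ξ l r t := by
  induction hd : r - l using Nat.strong_induction_on generalizing l r t with
  | _ d ih =>
    set T := (frontBirth H.death l r).toReal with hTdef
    have hw : IsWave H.death l r := .inr h
    have hTeq : frontBirth H.death l r = ENNReal.ofReal T := hw.ofReal_birth.symm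
    have hT0 : 0 ≤ T := ENNReal.toReal_nonneg
    rcases hT0.eq_or_lt with hT | hT
    · have hb0 : frontBirth H.death l r = 0 := by rw [hTeq, ← hT, ENNReal.ofReal_zero]
      obtain ⟨i, rfl, rfl, hi⟩ := H.exists_eq_of_birth_eq_zero h hb0
      have hT2 : T < t / 2 := by linarith
      have htL : t / 2 ∈ lifeSpan H.death (2 * i) (2 * i + 2) :=
        Icc_subset_lifeSpan hw.birth_mem ht ⟨hT2.le, by linarith⟩
      have h1 := H.mass_birth_le hc hf hvs h htL
      rw [← hTdef, ← hT, H.initial_mass i hi] at h1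
      have h2 := H.mass_sub h hT2 htL ht (by linarith)
      have h3 : 0 < ∫ τ in (t / 2)..t, (H.rightRate (2 * i) (2 * i + 2) τ +
          H.leftRate (2 * i) (2 * i + 2) τ) := by
        refine intervalIntegral.intervalIntegral_pos_of_pos_on
          (((H.continuousOn_rightRate hc hf h hT2 htL ht).add
            (H.continuousOn_leftRate hc hf h hT2 htL ht)).intervalIntegrable_of_Icc (by linarith))
          (fun τ hτ => ?_) (by linarith)
        have hat := hw.isFrontAt ht (hT2.trans hτ.1).le hτ.2
        exact add_pos_of_nonneg_of_pos (H.rightRate_nonneg hvs h (hT2.trans hτ.1) hat)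
          (H.leftRate_pos hvs h (by simp) (hT2.trans hτ.1) hat)
      linarith
    · refine lt_of_lt_of_le ?_ (H.mass_birth_le hc hf hvs h ht)
      rw [← hTdef, H.interaction_mass l r h T hT hTeq]
      have hp : ∀ p ∈ incoming H.death l r T, p.1 + 2 ≤ p.2 → 0 < H.ξ p.1 p.2 T := by
        intro p hp hp2
        have hb := ((mem_incoming hT).1 hp).2.2
        refine ih _ (hd ▸ width_lt_of_mem_incoming hT hTeq hp) ?_ hb.mem_lifeSpan hT rfl
        rcases hb.isWave with h | h
        · omega
        · exact h
      refine Finset.sum_pos' (fun p hpm => ?_) ?_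
      · by_cases hp2 : p.1 + 2 ≤ p.2
        · exact (hp p hpm hp2).le
        · have := ((mem_incoming hT).1 hpm).2.2.1
          rw [show p.2 = p.1 + 1 by omega, H.contact_mass]
      · obtain ⟨p, hpm, hp2⟩ := H.interaction_shadow l r h T hT hTeq
        exact ⟨p, hpm, hp p hpm hp2⟩

lemma mass_nonneg_of_isFrontBefore (hc : RelaxationCoefficients κ ua) (hf : Continuous f)
    (hvs : ∀ i, 0 < vs i) (h : IsFrontBefore H.death l r t) : 0 ≤ H.ξ l r t := by
  rcases h.isWave with rfl | hs
  · rw [H.contact_mass]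
  · exact (H.mass_pos hc hf hvs hs h.mem_lifeSpan h.2.1).le

/-! ### Paths and their order -/

lemma contactPath_sub (hc : RelaxationCoefficients κ ua) (hf : Continuous f) (hs : 0 ≤ s)
    (hst : s ≤ t) (k : ℕ) : contactPath f κ ua us Y k t - contactPath f κ ua us Y k s =
      ∫ τ in s..t, f (relax κ ua (us ((k + 1) / 2)) τ) := by
  have hI : ∀ b, 0 ≤ b → IntervalIntegrable (fun τ => f (relax κ ua (us ((k + 1) / 2)) τ))
      volume 0 b := fun b hb => ((hf.comp_continuousOn
        (hc.continuousOn_relax _)).mono Icc_subset_Ici_self).intervalIntegrable_of_Icc hb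
  rw [contactPath, contactPath, add_sub_add_left_eq_sub,
    intervalIntegral.integral_interval_sub_left (hI t (hs.trans hst)) (hI s hs)]

lemma continuousOn_contactPath (hc : RelaxationCoefficients κ ua) (hf : Continuous f) (k : ℕ) :
    ContinuousOn (contactPath f κ ua us Y k) (Ici 0) :=
  continuousOn_const.add (continuousOn_primitive_Ici fun _ hb => ((hf.comp_continuousOn
    (hc.continuousOn_relax _)).mono Icc_subset_Ici_self).intervalIntegrable_of_Icc hb)

lemma continuousOn_path (hc : RelaxationCoefficients κ ua) (hf : Continuous f)
    (h : IsWave H.death l r) : ContinuousOn (H.c l r) (lifeSpan H.death l r) := by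
  rcases h with rfl | h
  · exact ((continuousOn_contactPath hc hf l).mono fun _ hx => hx.1).congr
      fun t _ => H.contact_path l t
  · exact H.continuous_path l r h

lemma continuousOn_frontVelocity (hc : RelaxationCoefficients κ ua) (h : IsWave H.death l r)
    (hs : (frontBirth H.death l r).toReal < s) (hsL : s ∈ lifeSpan H.death l r)
    (ht : t ∈ lifeSpan H.death l r) : ContinuousOn (H.frontVelocity l r) (Icc s t) := by
  rcases h with rfl | h
  · exact ((hc.continuousOn_relax _).mono fun _ hx => hsL.1.trans hx.1).congr
      fun t _ => H.frontVelocity_contact l t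
  · rw [H.frontVelocity_shadow h]
    exact H.continuousOn_χ h hs hsL ht

lemma path_sub (hc : RelaxationCoefficients κ ua) (hf : Continuous f) (h : IsWave H.death l r)
    (hs : (frontBirth H.death l r).toReal < s) (hsL : s ∈ lifeSpan H.death l r)
    (ht : t ∈ lifeSpan H.death l r) (hst : s ≤ t) :
    H.c l r t - H.c l r s = ∫ τ in s..t, f (H.frontVelocity l r τ) := by
  rcases h with rfl | h
  · rw [H.contact_path, H.contact_path, contactPath_sub hc hf hsL.1 hst]
    simp only [frontVelocity_contact]
  · rw [H.path_eq l r h s hsL t ht (IsWave.birth_lt (.inr h) hs) hst, H.frontVelocity_shadow h]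

/-- The fronts at both sides of a medium do not cross: two contacts enclosing a vacuum spread, and
two contacts enclosing a state are parallel. -/
lemma path_le_path (hc : RelaxationCoefficients κ ua) (hf : Continuous f) (hf' : StrictMono f)
    (hY : Monotone Y) (h₁ : IsFrontAt H.death l m t) (h₂ : IsFrontAt H.death m r t) :
    H.c l m t ≤ H.c m r t := by
  by_cases hs : l + 2 ≤ m ∨ m + 2 ≤ r
  · exact (H.separated l m r t h₁ h₂ hs).le
  have e1 : m = l + 1 := by have := h₁.1; omega
  have e2 : r = l + 1 + 1 := by have := h₂.1; omega
  subst e1 e2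
  have ht := h₁.2.1
  rw [H.contact_path, H.contact_path, contactPath, contactPath]
  rcases Nat.even_or_odd' l with ⟨i, rfl | rfl⟩
  · have hus : us i ≤ us (i + 1) := by
      by_contra! hlt
      have := h₁.2.2.2.2
      rw [H.death_odd_zero i hlt] at this
      simp at this
    rw [show (2 * i + 1) / 2 = i by omega, show 2 * i / 2 = i by omega,
      show (2 * i + 1 + 1) / 2 = i + 1 by omega]
    refine add_le_add le_rfl (intervalIntegral.integral_mono_on ht ?_ ?_ fun τ _ =>
      hf'.monotone (relax_le_relax.2 hus)) <;>
    exact ((hf.comp_continuousOn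
      (hc.continuousOn_relax _)).mono Icc_subset_Ici_self).intervalIntegrable_of_Icc ht
  · rw [show (2 * i + 1) / 2 = i by omega, show (2 * i + 1 + 1) / 2 = i + 1 by omega,
      show (2 * i + 1 + 1 + 1) / 2 = i + 1 by omega]
    exact add_le_add (hY (Nat.le_succ i)) le_rfl

/-- Where two neighbouring fronts meet, the left one is at least as fast as the right one. -/
lemma frontVelocity_le_of_meet (hc : RelaxationCoefficients κ ua) (hf : Continuous f)
    (hf' : StrictMono f) (hY : Monotone Y) (h₁ : IsFrontBefore H.death l m T)
    (h₂ : IsFrontBefore H.death m r T) (hT : H.c l m T = H.c m r T) :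
    H.frontVelocity m r T ≤ H.frontVelocity l m T := by
  by_contra! hlt
  have hT0 := h₁.2.1
  set b := max (frontBirth H.death l m).toReal (frontBirth H.death m r).toReal with hb
  have hbT : b < T := max_lt h₁.birth_lt h₂.birth_lt
  obtain ⟨s₀, hs₀⟩ := exists_between hbT
  have hb1 : (frontBirth H.death l m).toReal < s₀ := (le_max_left _ _).trans_lt hs₀.1
  have hb2 : (frontBirth H.death m r).toReal < s₀ := (le_max_right _ _).trans_lt hs₀.1
  have hL1 : s₀ ∈ lifeSpan H.death l m :=
    Icc_subset_lifeSpan h₁.isWave.birth_mem h₁.mem_lifeSpan ⟨hb1.le, hs₀.2.le⟩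
  have hL2 : s₀ ∈ lifeSpan H.death m r :=
    Icc_subset_lifeSpan h₂.isWave.birth_mem h₂.mem_lifeSpan ⟨hb2.le, hs₀.2.le⟩
  have hc1 := hf.comp_continuousOn
    (H.continuousOn_frontVelocity hc h₁.isWave hb1 hL1 h₁.mem_lifeSpan)
  have hc2 := hf.comp_continuousOn
    (H.continuousOn_frontVelocity hc h₂.isWave hb2 hL2 h₂.mem_lifeSpan)
  have hTm : T ∈ Icc s₀ T := ⟨hs₀.2.le, le_rfl⟩
  have hev := (hc1 T hTm).eventually_lt (hc2 T hTm) (hf' hlt)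
  rw [eventually_nhdsWithin_iff, Metric.eventually_nhds_iff] at hev
  obtain ⟨η, hη, hball⟩ := hev
  set s₁ := max s₀ (T - η / 2) with hs₁
  have hs₁T : s₁ < T := max_lt hs₀.2 (by linarith)
  have hL1' := Icc_subset_lifeSpan hL1 h₁.mem_lifeSpan ⟨le_max_left _ _, hs₁T.le⟩
  have hL2' := Icc_subset_lifeSpan hL2 h₂.mem_lifeSpan ⟨le_max_left _ _, hs₁T.le⟩
  have hb1' := hb1.trans_le (le_max_left s₀ (T - η / 2))
  have hb2' := hb2.trans_le (le_max_left s₀ (T - η / 2))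
  have e1 := H.path_sub hc hf h₁.isWave hb1' hL1' h₁.mem_lifeSpan hs₁T.le
  have e2 := H.path_sub hc hf h₂.isWave hb2' hL2' h₂.mem_lifeSpan hs₁T.le
  have hord := H.path_le_path hc hf hf' hY (h₁.isWave.isFrontAt h₁.mem_lifeSpan hb1'.le hs₁T)
    (h₂.isWave.isFrontAt h₂.mem_lifeSpan hb2'.le hs₁T)
  have hsub : Icc s₁ T ⊆ Icc s₀ T := Icc_subset_Icc (le_max_left _ _) le_rfl
  have hint := intervalIntegral.integral_lt_integral_of_continuousOn_of_le_of_exists_lt hs₁T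
    (hc1.mono hsub) (hc2.mono hsub) (fun x hx => (hball ?_ (hsub ⟨hx.1.le, hx.2⟩)).le)
    ⟨T, ⟨hs₁T.le, le_rfl⟩, hf' hlt⟩
  · simp only [Function.comp_apply] at hint
    linarith
  · rw [Real.dist_eq, abs_sub_lt_iff]
    have := (le_max_right s₀ (T - η / 2)).trans_lt hx.1
    constructor <;> linarith [hx.2]

/-! ### Velocity of a shadow wave -/

/-- If `w` solves the relaxation law and lies, up to the sign `σ`, below the velocities of the
adjacent states, then `σ ξ (χ - w)` stays nonnegative when it is so at the birth of the wave: the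
mass swallowed by the wave brings an excess of momentum. -/
lemma excess_nonneg (hc : RelaxationCoefficients κ ua) (hf : Continuous f)
    (hvs : ∀ i, 0 < vs i) (h : IsShadowWave H.death l r) (σ w : ℝ)
    (hl : Even l → ∀ τ, 0 ≤ σ * (mediumVelocity κ ua us l τ - relax κ ua w τ))
    (hr : Even r → ∀ τ, 0 ≤ σ * (mediumVelocity κ ua us r τ - relax κ ua w τ))
    (hT : T = (frontBirth H.death l r).toReal)
    (h0 : 0 ≤ σ * (H.ξ l r T * H.χ l r T - H.ξ l r T * relax κ ua w T))
    (ht : t ∈ lifeSpan H.death l r) :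
    0 ≤ σ * (H.ξ l r t * H.χ l r t - H.ξ l r t * relax κ ua w t) := by
  have hw : IsWave H.death l r := .inr h
  have hL0 : lifeSpan H.death l r ⊆ Ici 0 := fun x hx => hx.1
  have hcont : ContinuousOn (fun t => σ * ((H.ξ l r t * H.χ l r t - H.ξ l r t * relax κ ua w t) *
      relaxFactor κ t)) (lifeSpan H.death l r) :=
    continuousOn_const.mul (((H.continuous_momentum l r h).sub ((H.continuous_mass l r h).mul
      ((hc.continuousOn_relax w).mono hL0))).mul (hc.continuousOn_relaxFactor.mono hL0))
  have key := H.le_of_le_after_birth (F := fun _ => (0 : ℝ)) hw continuousOn_const hcont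
    (fun s hs t ht hb hst => ?_) ht
  · rw [← hT] at key
    have h1 : 0 ≤ σ * (H.ξ l r T * H.χ l r T - H.ξ l r T * relax κ ua w T) * relaxFactor κ T :=
      mul_nonneg h0 (relaxFactor_pos κ T).le
    refine nonneg_of_mul_nonneg_left ?_ (relaxFactor_pos κ t)
    linarith
  · have hR := H.continuousOn_rightRate hc hf h hb hs ht
    have hLr := H.continuousOn_leftRate hc hf h hb hs ht
    have hVr := continuousOn_mediumVelocity (us := us) (t := t) hc hs.1 r
    have hVl := continuousOn_mediumVelocity (us := us) (t := t) hc hs.1 l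
    have hsub := Icc_subset_lifeSpan hs ht
    have e := hc.excess_momentum_eq (m := fun t => H.ξ l r t * H.χ l r t) (ξ := H.ξ l r)
      (g := fun τ => H.rightRate l r τ * mediumVelocity κ ua us r τ +
        H.leftRate l r τ * mediumVelocity κ ua us l τ)
      (q := fun τ => H.rightRate l r τ + H.leftRate l r τ) hs.1 hst.le
      ((hR.mul hVr).add (hLr.mul hVl)) (hR.add hLr)
      ((H.continuous_momentum l r h).mono hsub) ((H.continuous_mass l r h).mono hsub)
      (fun τ hτ => ?_) (fun τ hτ => H.mass_sub h hb hs (hsub hτ) hτ.1) w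
    · rw [sub_self, ← mul_sub, e, ← intervalIntegral.integral_const_mul]
      refine intervalIntegral.integral_nonneg_of_ae_restrict hst.le ?_
      have hae : ∀ᵐ τ : ℝ, τ ≠ t := by simp [ae_iff]
      refine (ae_restrict_iff' measurableSet_Icc).2 ?_
      filter_upwards [hae] with τ hne hτ
      have hat := hw.isFrontAt ht (hb.trans_le hτ.1).le (lt_of_le_of_ne hτ.2 hne)
      have r1 := H.rightRate_nonneg hvs h (hb.trans_le hτ.1) hat
      have r2 := H.leftRate_nonneg hvs h (hb.trans_le hτ.1) hat
      have a1 : 0 ≤ H.rightRate l r τ * (σ * (mediumVelocity κ ua us r τ - relax κ ua w τ)) := by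
        by_cases he : Even r
        · exact mul_nonneg r1 (hr he τ)
        · simp [rightRate, mediumDensity, he]
      have a2 : 0 ≤ H.leftRate l r τ * (σ * (mediumVelocity κ ua us l τ - relax κ ua w τ)) := by
        by_cases he : Even l
        · exact mul_nonneg r2 (hl he τ)
        · simp [leftRate, mediumDensity, he]
      refine (mul_nonneg (relaxFactor_pos κ τ).le (add_nonneg a1 a2)).trans_eq ?_
      ring
    · rw [H.momentum_eq l r h s hs τ (hsub hτ) (IsWave.birth_lt hw hb) hτ.1]
      refine intervalIntegral.integral_congr fun τ _ => ?_
      simp only [rightRate, leftRate]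
      ring

/-- The velocity of the wave `(l, r)` lies between those of the contacts which bound its outer media
towards the wave: `U_j` on the right, for `r = 2 * j` or `r = 2 * j + 1`, and `U_i` on the left, for
`l = 2 * i` or `l + 1 = 2 * i`. Waves that meet are ordered by decreasing velocities, so that this
passes to the mean velocity of the waves in an interaction. -/
theorem velocity_mem_Icc (hc : RelaxationCoefficients κ ua) (hf : Continuous f)
    (hf' : StrictMono f) (hvs : ∀ i, 0 < vs i) (hY : Monotone Y)
    (h : IsWave H.death l r) (ht : t ∈ lifeSpan H.death l r) (ht0 : 0 < t) :
    H.frontVelocity l r t ∈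
      Icc (relax κ ua (us (r / 2)) t) (relax κ ua (us ((l + 1) / 2)) t) := by
  induction hd : r - l using Nat.strong_induction_on generalizing l r t with
  | _ d ih =>
  rcases h with rfl | h
  · rw [H.frontVelocity_contact]
    exact ⟨le_rfl, le_rfl⟩
  have hw : IsWave H.death l r := .inr h
  rw [H.frontVelocity_shadow h]
  set T := (frontBirth H.death l r).toReal with hTdef
  have hTeq : frontBirth H.death l r = ENNReal.ofReal T := hw.ofReal_birth.symm
  have hT0 : 0 ≤ T := ENNReal.toReal_nonneg
  -- the claim at the birth, in the form that makes sense for a wave without mass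
  have birth : us (r / 2) ≤ us ((l + 1) / 2) ∧
      0 ≤ H.ξ l r T * H.χ l r T - H.ξ l r T * relax κ ua (us (r / 2)) T ∧
      H.ξ l r T * H.χ l r T - H.ξ l r T * relax κ ua (us ((l + 1) / 2)) T ≤ 0 := by
    rcases hT0.eq_or_lt with hT | hT
    · have hb0 : frontBirth H.death l r = 0 := by rw [hTeq, ← hT, ENNReal.ofReal_zero]
      obtain ⟨i, rfl, rfl, hi⟩ := H.exists_eq_of_birth_eq_zero h hb0
      rw [← hT, H.initial_mass i hi, show (2 * i + 2) / 2 = i + 1 by omega,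
        show (2 * i + 1) / 2 = i by omega]
      simp [hi.le]
    have hbefore : ∀ p ∈ incoming H.death l r T, IsFrontBefore H.death p.1 p.2 T :=
      fun p hp => ((mem_incoming hT).1 hp).2.2
    have hI : ∀ p ∈ incoming H.death l r T, H.frontVelocity p.1 p.2 T ∈
        Icc (relax κ ua (us (p.2 / 2)) T) (relax κ ua (us ((p.1 + 1) / 2)) T) := fun p hp =>
      ih _ (hd ▸ width_lt_of_mem_incoming hT hTeq hp) (hbefore p hp).isWave
        (hbefore p hp).mem_lifeSpan hT rfl
    have hmeet : ∀ p ∈ incoming H.death l r T, ∀ q ∈ incoming H.death l r T, p.2 = q.1 →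
        H.frontVelocity q.1 q.2 T ≤ H.frontVelocity p.1 p.2 T := by
      rintro ⟨a, b⟩ hp ⟨b', d⟩ hq (rfl : b = b')
      exact H.frontVelocity_le_of_meet hc hf hf' hY (hbefore _ hp) (hbefore _ hq)
        ((H.interaction_path l r h T hT hTeq _ hp).trans
          (H.interaction_path l r h T hT hTeq _ hq).symm)
    have hlow : ∀ n, ∀ p ∈ incoming H.death l r T, r - p.2 = n →
        relax κ ua (us (r / 2)) T ≤ H.frontVelocity p.1 p.2 T := by
      intro n
      induction n using Nat.strong_induction_on with
      | _ n ihn =>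
        intro p hp hn
        have hpr := ((mem_incoming hT).1 hp).2.1
        rcases hpr.eq_or_lt with he | hlt
        · rw [← he]
          exact (hI p hp).1
        · obtain ⟨e, he⟩ := exists_next_incoming h hT hTeq hp hlt
          have := (hbefore _ he).1
          exact (ihn (r - e) (by simp only at this; omega) _ he rfl).trans (hmeet p hp _ he rfl)
    have hupp : ∀ n, ∀ p ∈ incoming H.death l r T, p.1 - l = n →
        H.frontVelocity p.1 p.2 T ≤ relax κ ua (us ((l + 1) / 2)) T := by
      intro n
      induction n using Nat.strong_induction_on with
      | _ n ihn =>
        intro p hp hn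
        have hpl := ((mem_incoming hT).1 hp).1
        rcases hpl.eq_or_lt with he | hlt
        · rw [he]
          exact (hI p hp).2
        · obtain ⟨e, he⟩ := exists_previous_incoming h hT hTeq hp hlt
          have := (hbefore _ he).1
          have := ((mem_incoming hT).1 he).1
          exact (hmeet _ he p hp rfl).trans (ihn (e - l) (by simp only at *; omega) _ he rfl)
    have hmom : ∀ p ∈ incoming H.death l r T,
        H.ξ p.1 p.2 T * H.χ p.1 p.2 T = H.ξ p.1 p.2 T * H.frontVelocity p.1 p.2 T := by
      intro p hp
      rcases (hbefore p hp).isWave with he | he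
      · rw [he, H.contact_mass, zero_mul, zero_mul]
      · rw [H.frontVelocity_shadow he]
    have hm0 : ∀ p ∈ incoming H.death l r T, 0 ≤ H.ξ p.1 p.2 T := fun p hp =>
      H.mass_nonneg_of_isFrontBefore hc hf hvs (hbefore p hp)
    refine ⟨?_, ?_, ?_⟩
    · obtain ⟨a, ha⟩ := exists_last_incoming h hT hTeq
      exact (relax_le_relax (κ := κ) (ua := ua)).1 ((hlow _ _ ha rfl).trans (hupp _ _ ha rfl))
    · rw [H.interaction_momentum l r h T hT hTeq, H.interaction_mass l r h T hT hTeq,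
        Finset.sum_mul, ← Finset.sum_sub_distrib]
      refine Finset.sum_nonneg fun p hp => ?_
      rw [hmom p hp, ← mul_sub]
      exact mul_nonneg (hm0 p hp) (sub_nonneg.2 (hlow _ p hp rfl))
    · rw [H.interaction_momentum l r h T hT hTeq, H.interaction_mass l r h T hT hTeq,
        Finset.sum_mul, ← Finset.sum_sub_distrib]
      refine Finset.sum_nonpos fun p hp => ?_
      rw [hmom p hp, ← mul_sub]
      exact mul_nonpos_of_nonneg_of_nonpos (hm0 p hp) (sub_nonpos.2 (hupp _ p hp rfl))
  obtain ⟨hus, hlow, hupp⟩ := birth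
  have hξ := H.mass_pos hc hf hvs h ht ht0
  constructor
  · have := H.excess_nonneg hc hf hvs h 1 (us (r / 2)) (fun he τ => ?_) (fun _ τ => ?_) hTdef
      (by linarith) ht
    · rw [one_mul, ← mul_sub] at this
      exact sub_nonneg.1 (nonneg_of_mul_nonneg_right this hξ)
    · obtain ⟨i, rfl⟩ := he.two_dvd
      rw [one_mul, sub_nonneg]
      refine relax_le_relax.2 ?_
      rwa [show (2 * i + 1) / 2 = 2 * i / 2 by omega] at hus
    · rw [one_mul, mediumVelocity, sub_self]
  · have := H.excess_nonneg hc hf hvs h (-1) (us ((l + 1) / 2)) (fun he τ => ?_) (fun _ τ => ?_)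
      hTdef (by linarith) ht
    · rw [neg_one_mul, ← mul_sub, ← mul_neg, neg_sub] at this
      exact sub_nonneg.1 (nonneg_of_mul_nonneg_right this hξ)
    · obtain ⟨i, rfl⟩ := he.two_dvd
      rw [show (2 * i + 1) / 2 = 2 * i / 2 by omega, mediumVelocity, sub_self, mul_zero]
    · rw [neg_one_mul, neg_sub, sub_nonneg]
      exact relax_le_relax.2 hus

/-- A wave stays between the contacts which bound its outer media towards the wave. -/
theorem path_mem_Icc (hc : RelaxationCoefficients κ ua) (hf : Continuous f)
    (hf' : StrictMono f) (hvs : ∀ i, 0 < vs i) (hY : Monotone Y)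
    (h : IsWave H.death l r) (ht : t ∈ lifeSpan H.death l r) :
    H.c l r t ∈ Icc (contactPath f κ ua us Y (r - 1) t) (contactPath f κ ua us Y l t) := by
  induction hd : r - l using Nat.strong_induction_on generalizing l r t with
  | _ d ih =>
  rcases h with rfl | h
  · rw [H.contact_path]
    exact ⟨le_rfl, le_rfl⟩
  have hw : IsWave H.death l r := .inr h
  set T := (frontBirth H.death l r).toReal with hTdef
  have hTeq : frontBirth H.death l r = ENNReal.ofReal T := hw.ofReal_birth.symm
  have hT0 : 0 ≤ T := ENNReal.toReal_nonneg
  have birth : H.c l r T ∈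
      Icc (contactPath f κ ua us Y (r - 1) T) (contactPath f κ ua us Y l T) := by
    rcases hT0.eq_or_lt with hT | hT
    · have hb0 : frontBirth H.death l r = 0 := by rw [hTeq, ← hT, ENNReal.ofReal_zero]
      obtain ⟨i, rfl, rfl, hi⟩ := H.exists_eq_of_birth_eq_zero h hb0
      rw [← hT, H.initial_path i hi, contactPath, contactPath, intervalIntegral.integral_same,
        intervalIntegral.integral_same, show (2 * i + 2 - 1) / 2 = i by omega,
        show 2 * i / 2 = i by omega]
      simp
    constructor
    · obtain ⟨a, ha⟩ := exists_last_incoming h hT hTeq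
      have hb := ((mem_incoming hT).1 ha).2.2
      rw [← H.interaction_path l r h T hT hTeq _ ha]
      exact (ih _ (hd ▸ width_lt_of_mem_incoming hT hTeq ha) hb.isWave hb.mem_lifeSpan rfl).1
    · obtain ⟨a, ha⟩ := exists_first_incoming h hT hTeq
      have hb := ((mem_incoming hT).1 ha).2.2
      rw [← H.interaction_path l r h T hT hTeq _ ha]
      exact (ih _ (hd ▸ width_lt_of_mem_incoming hT hTeq ha) hb.isWave hb.mem_lifeSpan rfl).2
  have hcont : ∀ k, ContinuousOn (contactPath f κ ua us Y k) (lifeSpan H.death l r) := fun k =>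
    (continuousOn_contactPath hc hf k).mono fun _ hx => hx.1
  have hrelax : ∀ w s t, 0 ≤ s → s ≤ t →
      IntervalIntegrable (fun τ => f (relax κ ua w τ)) volume s t := fun w s t hs hst =>
    ((hf.comp_continuousOn (hc.continuousOn_relax w)).mono
      fun _ hx => hs.trans hx.1).intervalIntegrable_of_Icc hst
  constructor
  · have := H.le_of_le_after_birth hw (hcont (r - 1)) (H.continuousOn_path hc hf hw)
      (fun s hs t ht hb hst => ?_) ht
    · linarith [birth.1]
    · rw [contactPath_sub hc hf hs.1 hst.le, H.path_sub hc hf hw hb hs ht hst.le,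
        show r - 1 + 1 = r by have := hw.lt; omega]
      refine intervalIntegral.integral_mono_on hst.le (hrelax _ _ _ hs.1 hst.le)
        ((hf.comp_continuousOn
          (H.continuousOn_frontVelocity hc hw hb hs ht)).intervalIntegrable_of_Icc hst.le)
        fun τ hτ => hf'.monotone ?_
      exact (H.velocity_mem_Icc hc hf hf' hvs hY hw (Icc_subset_lifeSpan hs ht hτ)
        ((hT0.trans_lt hb).trans_le hτ.1)).1
  · have := H.le_of_le_after_birth hw (H.continuousOn_path hc hf hw) (hcont l)
      (fun s hs t ht hb hst => ?_) ht
    · linarith [birth.2]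
    · rw [contactPath_sub hc hf hs.1 hst.le, H.path_sub hc hf hw hb hs ht hst.le]
      refine intervalIntegral.integral_mono_on hst.le
        ((hf.comp_continuousOn
          (H.continuousOn_frontVelocity hc hw hb hs ht)).intervalIntegrable_of_Icc hst.le)
        (hrelax _ _ _ hs.1 hst.le) fun τ hτ => hf'.monotone ?_
      exact (H.velocity_mem_Icc hc hf hf' hvs hY hw (Icc_subset_lifeSpan hs ht hτ)
        ((hT0.trans_lt hb).trans_le hτ.1)).2

/-! ### Conservation of mass -/

/-- The mass of the initial data in `(Y 0, Y i]`. -/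
noncomputable def cumulativeMass (vs Y : ℕ → ℝ) : ℕ → ℝ
  | 0 => 0
  | i + 1 => cumulativeMass vs Y i + vs (i + 1) * (Y (i + 1) - Y i)

/-- The mass to the left of a point `x` of the medium `m` at time `t`, relative to that initially
to the left of `Y 0`. For a state, it is read off at the foot of the characteristic through
`(x, t)`; the affine extension to all `x` is used. -/
noncomputable def massPotential (f κ ua : ℝ → ℝ) (vs us Y : ℕ → ℝ) (m : ℕ) (x t : ℝ) : ℝ :=
  cumulativeMass vs Y (m / 2) + mediumDensity vs m * (x - contactPath f κ ua us Y m t)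

lemma mediumDensity_mul_contactPath_sub (hc : RelaxationCoefficients κ ua) (hf : Continuous f)
    (hs : 0 ≤ s) (hst : s ≤ t) (m : ℕ) :
    mediumDensity vs m * (contactPath f κ ua us Y m t - contactPath f κ ua us Y m s) =
      mediumDensity vs m * ∫ τ in s..t, f (mediumVelocity κ ua us m τ) := by
  by_cases he : Even m
  · obtain ⟨i, rfl⟩ := he.two_dvd
    rw [contactPath_sub hc hf hs hst, show (2 * i + 1) / 2 = 2 * i / 2 by omega]
    rfl
  · simp [mediumDensity, he]

/-- The mass potential has no jump across a contact discontinuity. -/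
lemma massPotential_contact (k : ℕ) (t : ℝ) :
    massPotential f κ ua vs us Y (k + 1) (contactPath f κ ua us Y k t) t =
      massPotential f κ ua vs us Y k (contactPath f κ ua us Y k t) t := by
  unfold massPotential
  rcases Nat.even_or_odd' k with ⟨i, rfl | rfl⟩
  · simp [mediumDensity, show (2 * i + 1) / 2 = i by omega]
  · have h1 : Even (2 * i + 1 + 1) := ⟨i + 1, by ring⟩
    rw [show (2 * i + 1 + 1) / 2 = i + 1 by omega, show (2 * i + 1) / 2 = i by omega]
    simp only [mediumDensity, if_pos h1, show (2 * i + 1 + 1) / 2 = i + 1 by omega, contactPath,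
      show (2 * i + 1) / 2 = i by omega, show (2 * i + 1 + 1 + 1) / 2 = i + 1 by omega,
      cumulativeMass]
    ring

/-- The mass of a wave is the jump of the mass potential across it. -/
theorem mass_eq_massPotential_sub (hc : RelaxationCoefficients κ ua) (hf : Continuous f)
    (h : IsWave H.death l r) (ht : t ∈ lifeSpan H.death l r) :
    H.ξ l r t = massPotential f κ ua vs us Y r (H.c l r t) t -
      massPotential f κ ua vs us Y l (H.c l r t) t := by
  induction hd : r - l using Nat.strong_induction_on generalizing l r t with
  | _ d ih =>
  rcases h with rfl | h
  · rw [H.contact_path, massPotential_contact, sub_self, H.contact_mass]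
  have hw : IsWave H.death l r := .inr h
  set T := (frontBirth H.death l r).toReal with hTdef
  have hTeq : frontBirth H.death l r = ENNReal.ofReal T := hw.ofReal_birth.symm
  have hT0 : 0 ≤ T := ENNReal.toReal_nonneg
  have birth : H.ξ l r T = massPotential f κ ua vs us Y r (H.c l r T) T -
      massPotential f κ ua vs us Y l (H.c l r T) T := by
    rcases hT0.eq_or_lt with hT | hT
    · have hb0 : frontBirth H.death l r = 0 := by rw [hTeq, ← hT, ENNReal.ofReal_zero]
      obtain ⟨i, rfl, rfl, hi⟩ := H.exists_eq_of_birth_eq_zero h hb0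
      rw [← hT, H.initial_path i hi, H.initial_mass i hi]
      simp [massPotential, contactPath, mediumDensity, cumulativeMass,
        show (2 * i + 2) / 2 = i + 1 by omega, show Even (2 * i + 2) from ⟨i + 1, by ring⟩]
      ring
    · rw [H.interaction_mass l r h T hT hTeq,
        ← sum_consecutivePairs_sub (A := fun m => ENNReal.ofReal T ≤ H.death m)
          (ofReal_le_death_left h hTeq) (ofReal_le_death_right h hTeq) hw.lt.le
          (fun m => massPotential f κ ua vs us Y m (H.c l r T) T), ← incoming_eq hT]
      refine Finset.sum_congr rfl fun p hp => ?_
      have hb := ((mem_incoming hT).1 hp).2.2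
      rw [ih _ (hd ▸ width_lt_of_mem_incoming hT hTeq hp) hb.isWave hb.mem_lifeSpan rfl,
        H.interaction_path l r h T hT hTeq _ hp]
  have hcont : ∀ m, ContinuousOn (fun t => massPotential f κ ua vs us Y m (H.c l r t) t)
      (lifeSpan H.death l r) := fun m => continuousOn_const.add (continuousOn_const.mul
    ((H.continuousOn_path hc hf hw).sub ((continuousOn_contactPath hc hf m).mono fun _ hx => hx.1)))
  have hincr : ∀ s ∈ lifeSpan H.death l r, ∀ t ∈ lifeSpan H.death l r, T < s → s < t →
      H.ξ l r t - H.ξ l r s = (massPotential f κ ua vs us Y r (H.c l r t) t -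
        massPotential f κ ua vs us Y l (H.c l r t) t) -
        (massPotential f κ ua vs us Y r (H.c l r s) s -
        massPotential f κ ua vs us Y l (H.c l r s) s) := by
    intro s hs t ht hb hst
    have hχ : IntervalIntegrable (fun τ => f (H.χ l r τ)) volume s t :=
      (hf.comp_continuousOn (H.continuousOn_χ h hb hs ht)).intervalIntegrable_of_Icc hst.le
    have hV : ∀ m, IntervalIntegrable (fun τ => f (mediumVelocity κ ua us m τ)) volume s t :=
      fun m => (hf.comp_continuousOn
        (continuousOn_mediumVelocity hc hs.1 m)).intervalIntegrable_of_Icc hst.le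
    have e : ∀ m, massPotential f κ ua vs us Y m (H.c l r t) t -
        massPotential f κ ua vs us Y m (H.c l r s) s =
        mediumDensity vs m * ∫ τ in s..t, (f (H.χ l r τ) - f (mediumVelocity κ ua us m τ)) := by
      intro m
      rw [intervalIntegral.integral_sub hχ (hV m), mul_sub,
        ← mediumDensity_mul_contactPath_sub (Y := Y) hc hf hs.1 hst.le,
        ← H.path_eq l r h s hs t ht (IsWave.birth_lt hw hb) hst.le]
      unfold massPotential
      ring
    have e1 := e r
    have e2 := e l
    rw [H.mass_sub h hb hs ht hst.le, sub_sub_sub_comm, e1, e2,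
      ← intervalIntegral.integral_const_mul, ← intervalIntegral.integral_const_mul,
      ← intervalIntegral.integral_sub ((hχ.sub (hV r)).const_mul _)
        ((hχ.sub (hV l)).const_mul _)]
    refine intervalIntegral.integral_congr fun τ _ => ?_
    simp only [rightRate, leftRate]
    ring
  have h1 := H.le_of_le_after_birth hw (H.continuous_mass l r h) ((hcont r).sub (hcont l))
    (fun s hs t ht hb hst => (hincr s hs t ht hb hst).le) ht
  have h2 := H.le_of_le_after_birth hw ((hcont r).sub (hcont l)) (H.continuous_mass l r h)
    (fun s hs t ht hb hst => (hincr s hs t ht hb hst).ge) ht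
  simp only [Pi.sub_apply] at h1 h2
  linarith

end WaveHistory

/-! ### Mass and velocity in a bounded region -/

/-- Bounds on the data that control the approximate solution up to the time `T`: `N` for the
densities, `B` and `F` for the velocities of the states and the corresponding speeds, and `G` for
the lengths of the cells. -/
structure DataBounds (f κ ua : ℝ → ℝ) (vs us Y : ℕ → ℝ) (T N B F G : ℝ) : Prop where
  density_pos : ∀ i, 0 < vs i
  density_le : ∀ i, vs i ≤ N
  velocity_le : ∀ i, ∀ t ∈ Icc 0 T, |relax κ ua (us i) t| ≤ B
  speed_le : ∀ i, ∀ t ∈ Icc 0 T, |f (relax κ ua (us i) t)| ≤ F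
  monotone_Y : Monotone Y
  cell_le : ∀ i, Y (i + 1) - Y i ≤ G
  tendsto_Y : Tendsto Y atTop atTop

namespace DataBounds

variable {f κ ua : ℝ → ℝ} {vs us Y : ℕ → ℝ} {T N B F G t : ℝ}

lemma density_bound_nonneg (hb : DataBounds f κ ua vs us Y T N B F G) : 0 ≤ N :=
  (hb.density_pos 0).le.trans (hb.density_le 0)

lemma speed_bound_nonneg (hb : DataBounds f κ ua vs us Y T N B F G) (hT : 0 ≤ T) : 0 ≤ F :=
  (abs_nonneg _).trans (hb.speed_le 0 0 ⟨le_rfl, hT⟩)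

lemma mediumDensity_le (hb : DataBounds f κ ua vs us Y T N B F G) (m : ℕ) :
    mediumDensity vs m ≤ N := by
  unfold mediumDensity
  split_ifs
  exacts [hb.density_le _, hb.density_bound_nonneg]

lemma abs_contactPath_sub_le (hb : DataBounds f κ ua vs us Y T N B F G) (ht : t ∈ Icc 0 T)
    (k : ℕ) : |contactPath f κ ua us Y k t - Y (k / 2)| ≤ F * T := by
  have hF := hb.speed_bound_nonneg (ht.1.trans ht.2)
  rw [contactPath, add_sub_cancel_left, ← Real.norm_eq_abs]
  refine (intervalIntegral.norm_integral_le_of_norm_le_const fun τ hτ => ?_).trans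
    (mul_le_mul_of_nonneg_left (b := |t - 0|) ?_ hF)
  · rw [uIoc_of_le ht.1] at hτ
    exact hb.speed_le _ τ ⟨hτ.1.le, hτ.2.trans ht.2⟩
  · rw [sub_zero, abs_of_nonneg ht.1]
    exact ht.2

lemma cumulativeMass_le (hb : DataBounds f κ ua vs us Y T N B F G) (i : ℕ) :
    WaveHistory.cumulativeMass vs Y i ≤ N * (Y i - Y 0) := by
  induction i with
  | zero => simp [WaveHistory.cumulativeMass]
  | succ i ih =>
    have := mul_le_mul_of_nonneg_right (hb.density_le (i + 1))
      (sub_nonneg.2 (hb.monotone_Y (Nat.le_succ i)))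
    rw [WaveHistory.cumulativeMass]
    linarith

end DataBounds

namespace WaveHistory

variable {f κ ua : ℝ → ℝ} {vs us Y : ℕ → ℝ} (H : WaveHistory f κ ua vs us Y)
  {T N B F G t : ℝ} {l m r : ℕ}

/-- `m` is present at time `t`. -/
abbrev IsAlive (t : ℝ) (m : ℕ) : Prop := ENNReal.ofReal t < H.death m

lemma exists_right_front (ht : 0 ≤ t) (hm : H.IsAlive t m) : ∃ r, IsFrontAt H.death m r t := by
  obtain ⟨k, hk, hka⟩ := H.alive_unbounded t (m + 1)
  obtain ⟨b, -, hb⟩ := IsConsecutive.exists_right (A := H.IsAlive t) hm hka hk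
  exact ⟨b, (isFrontAt_iff ht).2 hb⟩

lemma exists_left_front (ht : 0 ≤ t) (hm : H.IsAlive t m) (hm0 : 0 < m) :
    ∃ l, IsFrontAt H.death l m t := by
  obtain ⟨a, -, ha⟩ := IsConsecutive.exists_left (A := H.IsAlive t) (l := 0)
    (by rw [IsAlive, H.death_zero]; exact ENNReal.ofReal_lt_top) hm hm0
  exact ⟨a, (isFrontAt_iff ht).2 ha⟩

lemma path_ge (hc : RelaxationCoefficients κ ua) (hf : Continuous f) (hf' : StrictMono f)
    (hb : DataBounds f κ ua vs us Y T N B F G) (ht : t ∈ Icc 0 T)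
    (h : IsFrontAt H.death l r t) : Y ((r - 1) / 2) - F * T ≤ H.c l r t := by
  have h1 := (H.path_mem_Icc hc hf hf' hb.density_pos hb.monotone_Y h.isWave h.mem_lifeSpan).1
  have h2 := (abs_le.1 (hb.abs_contactPath_sub_le ht (r - 1))).1
  linarith

/-- The mass potential at the left boundary of a medium is at most the initial mass up to the end of
its cell. -/
lemma massPotential_le (hc : RelaxationCoefficients κ ua) (hf : Continuous f) (hf' : StrictMono f)
    (hb : DataBounds f κ ua vs us Y T N B F G) (ht : t ∈ Icc 0 T) (h : IsFrontAt H.death l r t) :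
    massPotential f κ ua vs us Y r (H.c l r t) t ≤ N * (H.c l r t + F * T + G - Y 0) := by
  obtain ⟨r', h'⟩ := H.exists_right_front ht.1 h.2.2.2.2
  have h1 := H.path_le_path hc hf hf' hb.monotone_Y h h'
  have h2 := (H.path_mem_Icc hc hf hf' hb.density_pos hb.monotone_Y h'.isWave h'.mem_lifeSpan).2
  have h3 := mul_nonpos_of_nonneg_of_nonpos (mediumDensity_nonneg hb.density_pos r)
    (sub_nonpos.2 (h1.trans h2))
  have h4 := hb.cumulativeMass_le (r / 2)
  have h5 := H.path_ge hc hf hf' hb ht h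
  have h6 : Y (r / 2) ≤ Y ((r - 1) / 2) + G := by
    have hle : r / 2 ≤ (r - 1) / 2 + 1 := by omega
    have := hb.monotone_Y hle
    have := hb.cell_le ((r - 1) / 2)
    linarith
  have h7 : N * (Y (r / 2) - Y 0) ≤ N * (H.c l r t + F * T + G - Y 0) :=
    mul_le_mul_of_nonneg_left (by linarith) hb.density_bound_nonneg
  unfold massPotential
  linarith

/-- The shadow waves to the left of a medium carry together no more than the mass potential there,
apart from the mass that may have entered from the leftmost state. -/
lemma sum_mass_le_massPotential (hc : RelaxationCoefficients κ ua) (hf : Continuous f)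
    (hf' : StrictMono f) (hb : DataBounds f κ ua vs us Y T N B F G) (ht : t ∈ Icc 0 T)
    (h : IsFrontAt H.death l r t) :
    ∑ p ∈ consecutivePairs (H.IsAlive t) 0 r, H.ξ p.1 p.2 t ≤
      massPotential f κ ua vs us Y r (H.c l r t) t + N * (2 * F * T) := by
  induction r using Nat.strong_induction_on generalizing l with
  | _ r ih =>
  have hcons := (isFrontAt_iff ht.1).1 h
  rw [sum_consecutivePairs (Nat.zero_le l) hcons,
    H.mass_eq_massPotential_sub hc hf h.isWave h.mem_lifeSpan]
  rcases Nat.eq_zero_or_pos l with rfl | hl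
  · rw [consecutivePairs_self, Finset.sum_empty, add_zero]
    have h1 := H.path_ge hc hf hf' hb ht h
    have h2 := (abs_le.1 (hb.abs_contactPath_sub_le ht 0)).2
    have h3 := hb.monotone_Y (Nat.zero_le ((r - 1) / 2))
    have h4 : mediumDensity vs 0 * (contactPath f κ ua us Y 0 t - H.c 0 r t) ≤ N * (2 * F * T) := by
      have hF := mul_nonneg (hb.speed_bound_nonneg (ht.1.trans ht.2)) (ht.1.trans ht.2)
      refine (mul_le_mul_of_nonneg_left (c := 2 * F * T) ?_
        (mediumDensity_nonneg hb.density_pos 0)).trans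
        (mul_le_mul_of_nonneg_right (hb.mediumDensity_le 0) (by linarith))
      simp only [Nat.zero_div] at h2
      linarith
    have h5 : massPotential f κ ua vs us Y 0 (H.c 0 r t) t =
        -(mediumDensity vs 0 * (contactPath f κ ua us Y 0 t - H.c 0 r t)) := by
      simp only [massPotential, Nat.zero_div, cumulativeMass]
      ring
    linarith
  · obtain ⟨k, hk⟩ := H.exists_left_front ht.1 h.2.2.2.1 hl
    have h1 := ih l h.1 hk
    have h2 := H.path_le_path hc hf hf' hb.monotone_Y hk h
    have h3 : massPotential f κ ua vs us Y l (H.c k l t) t ≤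
        massPotential f κ ua vs us Y l (H.c l r t) t := by
      unfold massPotential
      have := mul_le_mul_of_nonneg_left h2 (mediumDensity_nonneg hb.density_pos l)
      linarith
    linarith

lemma mass_nonneg (hc : RelaxationCoefficients κ ua) (hf : Continuous f)
    (hvs : ∀ i, 0 < vs i) (ht0 : 0 < t) (h : IsFrontAt H.death l r t) : 0 ≤ H.ξ l r t := by
  rcases h.isWave with rfl | hs
  · rw [H.contact_mass]
  · exact (H.mass_pos hc hf hvs hs h.mem_lifeSpan ht0).le

/-- The waves with central lines in `(-∞, a]` carry a mass which is bounded in terms of the data. -/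
theorem sum_mass_le (hc : RelaxationCoefficients κ ua) (hf : Continuous f)
    (hf' : StrictMono f) (hb : DataBounds f κ ua vs us Y T N B F G) (ht : t ∈ Icc 0 T) (ht0 : 0 < t)
    (S : Finset (ℕ × ℕ)) {a : ℝ}
    (hS : ∀ p ∈ S, IsFrontAt H.death p.1 p.2 t ∧ H.c p.1 p.2 t ≤ a) :
    ∑ p ∈ S, H.ξ p.1 p.2 t ≤ N * (max 0 (a + F * T + G - Y 0) + 2 * F * T) := by
  have hN := hb.density_bound_nonneg
  have hF := mul_nonneg (hb.speed_bound_nonneg (ht.1.trans ht.2)) (ht.1.trans ht.2)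
  rcases S.eq_empty_or_nonempty with rfl | hne
  · rw [Finset.sum_empty]
    have := le_max_left 0 (a + F * T + G - Y 0)
    exact mul_nonneg hN (by linarith)
  obtain ⟨q, hq, hmax⟩ := S.exists_max_image (fun p => p.2) hne
  have hsub : S ⊆ consecutivePairs (H.IsAlive t) 0 q.2 := fun p hp =>
    mem_consecutivePairs.2 ⟨Nat.zero_le _, hmax p hp, (isFrontAt_iff ht.1).1 (hS p hp).1⟩
  refine (Finset.sum_le_sum_of_subset_of_nonneg hsub fun p hp _ => ?_).trans
    ((H.sum_mass_le_massPotential hc hf hf' hb ht (hS q hq).1).trans ?_)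
  · exact H.mass_nonneg hc hf hb.density_pos ht0
      ((isFrontAt_iff ht.1).2 (mem_consecutivePairs.1 hp).2.2)
  · have h1 := H.massPotential_le hc hf hf' hb ht (hS q hq).1
    have h2 : N * (H.c q.1 q.2 t + F * T + G - Y 0) ≤ N * max 0 (a + F * T + G - Y 0) :=
      mul_le_mul_of_nonneg_left (le_max_of_le_right (by linarith [(hS q hq).2])) hN
    linarith

/-- Only finitely many fronts lie in `(-∞, a]`. -/
lemma exists_forall_le_of_path_le (hc : RelaxationCoefficients κ ua) (hf : Continuous f)
    (hf' : StrictMono f) (hb : DataBounds f κ ua vs us Y T N B F G) (ht : t ∈ Icc 0 T) (a : ℝ) :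
    ∃ n : ℕ, ∀ l r, IsFrontAt H.death l r t → H.c l r t ≤ a → r ≤ n := by
  obtain ⟨i, hi⟩ := (hb.tendsto_Y.eventually_gt_atTop (a + F * T)).exists
  refine ⟨2 * i, fun l r h hle => ?_⟩
  by_contra! hlt
  have h1 := H.path_ge hc hf hf' hb ht h
  have hle' : i ≤ (r - 1) / 2 := by omega
  have h2 := hb.monotone_Y hle'
  linarith

/-- Each point off the fronts lies in a medium. -/
lemma exists_medium (hc : RelaxationCoefficients κ ua) (hf : Continuous f)
    (hf' : StrictMono f) (hb : DataBounds f κ ua vs us Y T N B F G) (ht : t ∈ Icc 0 T) {x : ℝ}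
    (hx : ∀ l r, H.c l r t ≠ x) : ∃ m, H.IsAlive t m ∧
      (∀ l, IsFrontAt H.death l m t → H.c l m t < x) ∧
      (∀ r, IsFrontAt H.death m r t → x < H.c m r t) := by
  classical
  obtain ⟨n, hn⟩ := H.exists_forall_le_of_path_le hc hf hf' hb ht x
  by_cases hex : ∃ r, r ≤ n ∧ ∃ l, IsFrontAt H.death l r t ∧ H.c l r t < x
  · obtain ⟨r₀, hr₀, hex'⟩ := hex
    obtain ⟨l, hl, hlx⟩ := Nat.findGreatest_spec
      (P := fun r => ∃ l, IsFrontAt H.death l r t ∧ H.c l r t < x) hr₀ hex'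
    set m := Nat.findGreatest (fun r => ∃ l, IsFrontAt H.death l r t ∧ H.c l r t < x) n
    refine ⟨m, hl.2.2.2.2, fun l' hl' => ?_, fun r hr => ?_⟩
    · rwa [((isFrontAt_iff ht.1).1 hl').left_unique ((isFrontAt_iff ht.1).1 hl)]
    · by_contra! hle
      have h1 := Nat.le_findGreatest
        (P := fun r => ∃ l, IsFrontAt H.death l r t ∧ H.c l r t < x)
        (hn m r hr hle) ⟨m, hr, lt_of_le_of_ne hle (hx m r)⟩
      exact absurd hr.1 (not_lt.2 h1)
  · push Not at hex
    refine ⟨0, by rw [IsAlive, H.death_zero]; exact ENNReal.ofReal_lt_top,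
      fun l hl => absurd hl.1 (Nat.not_lt_zero l), fun r hr => ?_⟩
    by_contra! hle
    exact absurd (hex r (hn 0 r hr hle) 0 hr) (not_le.2 (lt_of_le_of_ne hle (hx 0 r)))

end WaveHistory

namespace ShadowWaveApproximation

variable {f κ ua : ℝ → ℝ} {vs us Y : ℕ → ℝ} {ε C δ : ℝ}
  (W : ShadowWaveApproximation f κ ua vs us Y ε C δ) {T N B F G t x : ℝ} {l r : ℕ}

/-- The half-width of the strip around the central line of the shadow wave `(l, r)`. -/
noncomputable def halfWidth (l r : ℕ) (t : ℝ) : ℝ :=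
  ε / 2 * (t - (frontBirth W.death l r).toReal) + W.offset l r

/-- The points at time `t` on the fronts and on the boundaries of the strips. -/
def exceptionalSet (t : ℝ) : Set ℝ :=
  {x | ∃ l r, W.c l r t = x ∨ |x - W.c l r t| = W.halfWidth l r t}

lemma countable_exceptionalSet (t : ℝ) : (W.exceptionalSet t).Countable := by
  have : W.exceptionalSet t ⊆ ⋃ p : ℕ × ℕ, {W.c p.1 p.2 t, W.c p.1 p.2 t + W.halfWidth p.1 p.2 t,
      W.c p.1 p.2 t - W.halfWidth p.1 p.2 t} := by
    rintro x ⟨l, r, h⟩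
    refine mem_iUnion.2 ⟨(l, r), ?_⟩
    simp only [mem_insert_iff, mem_singleton_iff]
    rcases h with h | h
    · exact .inl h.symm
    · rcases eq_or_eq_neg_of_abs_eq h with h | h
      · exact .inr (.inl (by linarith))
      · exact .inr (.inr (by linarith))
  exact (countable_iUnion fun p => by
    simp only [countable_insert, countable_singleton]).mono this

/-- Off the exceptional set, the approximate solution takes either the inner state of a strip or the
value prescribed in a medium. -/
lemma inside_or_outside (hc : RelaxationCoefficients κ ua) (hf : Continuous f)
    (hf' : StrictMono f) (hb : DataBounds f κ ua vs us Y T N B F G) (ht : t ∈ Icc 0 T) (ht0 : 0 < t)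
    (hx : x ∉ W.exceptionalSet t) :
    (∃ l r, IsShadowWave W.death l r ∧ IsFrontAt W.death l r t ∧
      |x - W.c l r t| < W.halfWidth l r t ∧ W.v x t = W.vin l r t ∧ W.u x t = W.uin l r t) ∨
    ∃ m, W.IsAlive t m ∧ (∀ l, IsFrontAt W.death l m t → W.c l m t < x) ∧
      (∀ r, IsFrontAt W.death m r t → x < W.c m r t) ∧ W.v x t = mediumDensity vs m ∧
      W.u x t = if Even m then mediumVelocity κ ua us m t else W.z (m / 2) x t := by
  have hx' : ∀ l r, W.c l r t ≠ x ∧ |x - W.c l r t| ≠ W.halfWidth l r t := fun l r =>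
    ⟨fun h => hx ⟨l, r, .inl h⟩, fun h => hx ⟨l, r, .inr h⟩⟩
  by_cases hin : ∃ l r, IsShadowWave W.death l r ∧ IsFrontAt W.death l r t ∧
      |x - W.c l r t| < ε / 2 * (t - (frontBirth W.death l r).toReal) + W.offset l r
  · exact .inl (W.value_inside x t ht0 hin)
  · push Not at hin
    obtain ⟨m, hm, hl, hr⟩ := W.exists_medium hc hf hf' hb ht fun l r => (hx' l r).1
    exact .inr ⟨m, hm, hl, hr, W.value_outside x t ht0
      (fun l r h1 h2 => lt_of_le_of_ne (hin l r h1 h2) (Ne.symm (hx' l r).2)) m hm hl hr⟩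

/-- The approximate velocity is bounded in terms of the data. -/
theorem abs_u_le (hc : RelaxationCoefficients κ ua) (hf : Continuous f)
    (hf' : StrictMono f) (hb : DataBounds f κ ua vs us Y T N B F G) (ht : t ∈ Icc 0 T) (ht0 : 0 < t)
    (hx : x ∉ W.exceptionalSet t) : |W.u x t| ≤ B + |δ| := by
  have hmem : ∀ {y i j}, y ∈ Icc (relax κ ua (us i) t) (relax κ ua (us j) t) → |y| ≤ B := by
    intro y i j hy
    have h1 := abs_le.1 (hb.velocity_le i t ht)
    have h2 := abs_le.1 (hb.velocity_le j t ht)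
    exact abs_le.2 ⟨h1.1.trans hy.1, hy.2.trans h2.2⟩
  rcases W.inside_or_outside hc hf hf' hb ht ht0 hx with
    ⟨l, r, h1, h2, -, -, h5⟩ | ⟨m, hm, hl, hr, -, h5⟩
  · have e1 := W.uin_approx l r h1 t ht0 h2
    have e2 := W.velocity_mem_Icc hc hf hf' hb.density_pos hb.monotone_Y h2.isWave
      h2.mem_lifeSpan ht0
    rw [W.frontVelocity_shadow h1] at e2
    have e3 := hmem e2
    rw [h5]
    have e4 := abs_sub_abs_le_abs_sub (W.uin l r t) (W.χ l r t)
    linarith [le_abs_self δ]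
  · refine le_trans ?_ (le_add_of_nonneg_right (abs_nonneg δ))
    rw [h5]
    split_ifs with he
    · exact hb.velocity_le _ t ht
    · obtain ⟨i, rfl⟩ := Nat.not_even_iff_odd.1 he
      have hus : us i ≤ us (i + 1) := by
        by_contra! hlt
        rw [WaveHistory.IsAlive, W.death_odd_zero i hlt] at hm
        simp at hm
      obtain ⟨a, ha⟩ := W.exists_left_front ht.1 hm (by omega)
      obtain ⟨b, hb'⟩ := W.exists_right_front ht.1 hm
      have e1 := (W.path_mem_Icc hc hf hf' hb.density_pos hb.monotone_Y ha.isWave ha.mem_lifeSpan).1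
      have e2 := (W.path_mem_Icc hc hf hf' hb.density_pos hb.monotone_Y hb'.isWave
        hb'.mem_lifeSpan).2
      rw [show (2 * i + 1) / 2 = i by omega]
      exact hmem (W.z_mem i hus t ht0 x ⟨e1.trans (hl a ha).le, (hr b hb').le.trans e2⟩)

lemma v_nonneg (hc : RelaxationCoefficients κ ua) (hf : Continuous f)
    (hf' : StrictMono f) (hb : DataBounds f κ ua vs us Y T N B F G) (ht : t ∈ Icc 0 T) (ht0 : 0 < t)
    (hx : x ∉ W.exceptionalSet t) (hδ : δ < 1) : 0 ≤ W.v x t := by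
  rcases W.inside_or_outside hc hf hf' hb ht ht0 hx with
    ⟨l, r, h1, h2, h3, h4, -⟩ | ⟨m, -, -, -, h4, -⟩
  · have e1 := (abs_le.1 (W.vin_approx l r h1 t ht0 h2)).1
    have e2 := W.mass_pos hc hf hb.density_pos h1 h2.mem_lifeSpan ht0
    have e3 : 0 < W.halfWidth l r t := (abs_nonneg _).trans_lt h3
    have e4 := mul_pos (sub_pos.2 hδ) e2
    rw [h4]
    refine (pos_of_mul_pos_right (a := 2 * W.halfWidth l r t) ?_ (by linarith)).le
    unfold halfWidth
    linarith
  · rw [h4]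
    exact WaveHistory.mediumDensity_nonneg hb.density_pos m

lemma halfWidth_le (hε : 0 < ε) (ht : t ∈ Icc 0 T) (h : IsShadowWave W.death l r) :
    W.halfWidth l r t ≤ ε * (T / 2 + |C|) := by
  have h1 : ε / 2 * (t - (frontBirth W.death l r).toReal) ≤ ε / 2 * T := by
    have : 0 ≤ (frontBirth W.death l r).toReal := ENNReal.toReal_nonneg
    exact mul_le_mul_of_nonneg_left (by linarith [ht.2]) (by linarith)
  have h2 : W.offset l r ≤ ε * |C| := by
    rcases eq_zero_or_pos (frontBirth W.death l r) with h0 | h0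
    · rw [W.offset_initial l r h h0]
      positivity
    · refine (W.offset_le l r h h0).trans ?_
      rw [mul_comm]
      exact mul_le_mul_of_nonneg_left (le_abs_self C) hε.le
  unfold halfWidth
  linarith

/-- The mass in the strip of a shadow wave is that of the wave, up to the relative error `δ`. -/
lemma strip_mass_le (hc : RelaxationCoefficients κ ua) (hf : Continuous f) (hvs : ∀ i, 0 < vs i)
    (ht0 : 0 < t) (h : IsShadowWave W.death l r) (hat : IsFrontAt W.death l r t) :
    ENNReal.ofReal |W.vin l r t| * volume (Metric.ball (W.c l r t) (W.halfWidth l r t)) ≤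
      ENNReal.ofReal ((1 + |δ|) * W.ξ l r t) := by
  rw [Real.volume_ball, ← ENNReal.ofReal_mul (abs_nonneg _)]
  refine ENNReal.ofReal_le_ofReal ?_
  have e1 := W.vin_approx l r h t ht0 hat
  have e2 := W.mass_pos hc hf hvs h hat.mem_lifeSpan ht0
  have e3 := mul_le_mul_of_nonneg_right (le_abs_self δ) e2.le
  have e4 := abs_sub_abs_le_abs_sub
    (2 * (ε / 2 * (t - (frontBirth W.death l r).toReal) + W.offset l r) * W.vin l r t) (W.ξ l r t)
  have e5 : |W.vin l r t| * (2 * W.halfWidth l r t) ≤ |2 * W.halfWidth l r t * W.vin l r t| := by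
    rw [abs_mul, mul_comm]
    exact mul_le_mul_of_nonneg_right (le_abs_self _) (abs_nonneg _)
  rw [abs_of_pos e2] at e4
  unfold halfWidth at e5 ⊢
  linarith

/-- The approximate density has a bounded mass in each bounded interval. -/
theorem lintegral_v_le (hc : RelaxationCoefficients κ ua) (hf : Continuous f)
    (hf' : StrictMono f) (hb : DataBounds f κ ua vs us Y T N B F G) (ht : t ∈ Icc 0 T) (ht0 : 0 < t)
    (hε : 0 < ε) {L : ℝ} (hL : 0 ≤ L) :
    ∫⁻ x in Icc (-L) L, ‖W.v x t‖ₑ ≤ ENNReal.ofReal (N * (2 * L) + (1 + |δ|) *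
      (N * (max 0 (L + ε * (T / 2 + |C|) + F * T + G - Y 0) + 2 * F * T))) := by
  classical
  have hN := hb.density_bound_nonneg
  set a := L + ε * (T / 2 + |C|) with ha
  obtain ⟨n, hn⟩ := W.exists_forall_le_of_path_le hc hf hf' hb ht a
  set S := (consecutivePairs (W.IsAlive t) 0 n).filter
    fun p => IsShadowWave W.death p.1 p.2 ∧ W.c p.1 p.2 t ≤ a with hS
  have hSmem : ∀ p ∈ S, IsFrontAt W.death p.1 p.2 t ∧ W.c p.1 p.2 t ≤ a := fun p hp => by
    rw [hS, Finset.mem_filter, mem_consecutivePairs] at hp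
    exact ⟨(isFrontAt_iff ht.1).2 hp.1.2.2, hp.2.2⟩
  have hSshadow : ∀ p ∈ S, IsShadowWave W.death p.1 p.2 := fun p hp => by
    rw [hS, Finset.mem_filter] at hp
    exact hp.2.1
  have hpt : ∀ᵐ x ∂(volume.restrict (Icc (-L) L)), ‖W.v x t‖ₑ ≤ ENNReal.ofReal N +
      ∑ p ∈ S, (Metric.ball (W.c p.1 p.2 t) (W.halfWidth p.1 p.2 t)).indicator
        (fun _ => ENNReal.ofReal |W.vin p.1 p.2 t|) x := by
    refine (ae_restrict_iff' measurableSet_Icc).2 ?_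
    filter_upwards [(W.countable_exceptionalSet t).ae_notMem volume] with x hx hxL
    rcases W.inside_or_outside hc hf hf' hb ht ht0 hx with
      ⟨l, r, h1, h2, h3, h4, -⟩ | ⟨m, -, -, -, h4, -⟩
    · have hca : W.c l r t ≤ a := by
        have e1 := W.halfWidth_le hε ht h1
        have e2 := (abs_lt.1 h3).1
        linarith [hxL.2]
      have hp : (l, r) ∈ S := by
        rw [hS, Finset.mem_filter, mem_consecutivePairs]
        exact ⟨⟨Nat.zero_le _, hn l r h2 hca, (isFrontAt_iff ht.1).1 h2⟩, h1, hca⟩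
      refine le_add_left (le_trans ?_ (Finset.single_le_sum (f := fun p : ℕ × ℕ =>
        (Metric.ball (W.c p.1 p.2 t) (W.halfWidth p.1 p.2 t)).indicator
        (fun _ => ENNReal.ofReal |W.vin p.1 p.2 t|) x) (fun _ _ => zero_le) hp))
      rw [indicator_of_mem (by rw [Metric.mem_ball, Real.dist_eq]; exact h3), h4,
        Real.enorm_eq_ofReal_abs]
    · refine le_add_right ?_
      rw [h4, Real.enorm_eq_ofReal_abs,
        abs_of_nonneg (WaveHistory.mediumDensity_nonneg hb.density_pos m)]
      exact ENNReal.ofReal_le_ofReal (hb.mediumDensity_le m)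
  have hsum := W.sum_mass_le hc hf hf' hb ht ht0 S hSmem
  have hξ : ∀ p ∈ S, 0 ≤ W.ξ p.1 p.2 t := fun p hp =>
    W.mass_nonneg hc hf hb.density_pos ht0 (hSmem p hp).1
  calc ∫⁻ x in Icc (-L) L, ‖W.v x t‖ₑ
      ≤ ∫⁻ x in Icc (-L) L, (ENNReal.ofReal N +
        ∑ p ∈ S, (Metric.ball (W.c p.1 p.2 t) (W.halfWidth p.1 p.2 t)).indicator
          (fun _ => ENNReal.ofReal |W.vin p.1 p.2 t|) x) := lintegral_mono_ae hpt
    _ = ENNReal.ofReal N * volume (Icc (-L) L) + ∑ p ∈ S, ENNReal.ofReal |W.vin p.1 p.2 t| *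
          volume.restrict (Icc (-L) L) (Metric.ball (W.c p.1 p.2 t) (W.halfWidth p.1 p.2 t)) := by
        rw [lintegral_add_left measurable_const, setLIntegral_const, lintegral_finsetSum]
        · congr 1
          exact Finset.sum_congr rfl fun p _ =>
            lintegral_indicator_const Metric.isOpen_ball.measurableSet _
        · exact fun p _ => measurable_const.indicator Metric.isOpen_ball.measurableSet
    _ ≤ ENNReal.ofReal (N * (2 * L)) + ∑ p ∈ S, ENNReal.ofReal ((1 + |δ|) * W.ξ p.1 p.2 t) := by
        refine add_le_add ?_ (Finset.sum_le_sum fun p hp => ?_)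
        · rw [Real.volume_Icc, ENNReal.ofReal_mul hN, show L - -L = 2 * L by ring]
        · exact (mul_le_mul_right (Measure.restrict_le_self _) _).trans
            (W.strip_mass_le hc hf hb.density_pos ht0 (hSshadow p hp) (hSmem p hp).1)
    _ ≤ _ := by
        rw [← ENNReal.ofReal_sum_of_nonneg fun p hp => mul_nonneg (by positivity) (hξ p hp),
          ← ENNReal.ofReal_add (by positivity) (Finset.sum_nonneg fun p hp =>
            mul_nonneg (by positivity) (hξ p hp)), ← Finset.mul_sum]
        exact ENNReal.ofReal_le_ofReal (add_le_add le_rfl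
          (mul_le_mul_of_nonneg_left hsum (by positivity)))

end ShadowWaveApproximation

/-! ### Vague compactness of measures -/

lemma abs_integral_le_of_support_subset {X : Type*} [MeasurableSpace X] {μ : Measure X}
    {K : Set X} {M η : ℝ}
    (hK : μ K ≤ ENNReal.ofReal M) (hM : 0 ≤ M) {g : X → ℝ} (hg : ∀ x, x ∉ K → g x = 0)
    (hη : ∀ x ∈ K, |g x| ≤ η) (hη0 : 0 ≤ η) : |∫ x, g x ∂μ| ≤ η * M := by
  rw [← setIntegral_eq_integral_of_forall_compl_eq_zero hg, ← Real.norm_eq_abs]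
  refine (norm_setIntegral_le_of_norm_le_const (hK.trans_lt ENNReal.ofReal_lt_top) hη).trans ?_
  refine mul_le_mul_of_nonneg_left ?_ hη0
  exact ENNReal.toReal_le_of_le_ofReal hM hK

section Vague

variable {X : Type*} [TopologicalSpace X] [MeasurableSpace X] [BorelSpace X]

/-- A sequence of measures which is bounded on compact sets has a subsequence whose integrals of
continuous functions with compact support converge: one extracts a subsequence that works for a
countable dense set of test functions. -/
lemma exists_subseq_tendsto_integral [T2Space X] [LocallyCompactSpace X]
    [SecondCountableTopology X] (μ : ℕ → Measure X)
    (hμ : ∀ K, IsCompact K → ∃ M : ℝ, ∀ n, μ n K ≤ ENNReal.ofReal M) :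
    ∃ φ : ℕ → ℕ, StrictMono φ ∧ ∀ g : X → ℝ, Continuous g → HasCompactSupport g →
      ∃ l, Tendsto (fun j => ∫ x, g x ∂(μ (φ j))) atTop (𝓝 l) := by
  have hfin : ∀ n, IsFiniteMeasureOnCompacts (μ n) := fun n => ⟨fun K hK => by
    obtain ⟨M, hM⟩ := hμ K hK
    exact (hM n).trans_lt ENNReal.ofReal_lt_top⟩
  let E := CompactExhaustion.choice X
  have hM : ∀ k, ∃ M : ℝ, 0 ≤ M ∧ ∀ n, μ n (E k) ≤ ENNReal.ofReal M := fun k => by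
    obtain ⟨M, hM⟩ := hμ _ (E.isCompact k)
    exact ⟨max M 0, le_max_right _ _, fun n =>
      (hM n).trans (ENNReal.ofReal_le_ofReal (le_max_left _ _))⟩
  choose M hM0 hM using hM
  let S : ℕ → Set C(X, ℝ) := fun k => {g | ∀ x, x ∉ E k → g x = 0}
  have hne : ∀ k, Nonempty (S k) := fun k => ⟨⟨0, fun _ _ => rfl⟩⟩
  let ψ : ℕ × ℕ → C(X, ℝ) := fun i => (TopologicalSpace.denseSeq (S i.1) i.2 : C(X, ℝ))
  have hψ : ∀ i, ∀ x, x ∉ E i.1 → ψ i x = 0 := fun i =>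
    (TopologicalSpace.denseSeq (S i.1) i.2).2
  have hbd : ∀ i, ∃ b : ℝ, ∀ n, ∫ x, ψ i x ∂(μ n) ∈ Icc (-b) b := fun i => by
    obtain ⟨c, hc⟩ := (E.isCompact i.1).exists_bound_of_continuousOn (ψ i).continuous.continuousOn
    refine ⟨max c 0 * M i.1, fun n => abs_le.1 ?_⟩
    exact abs_integral_le_of_support_subset (hM i.1 n) (hM0 i.1) (hψ i)
      (fun x hx => (hc x hx).trans (le_max_left _ _)) (le_max_right _ _)
  choose b hb using hbd
  obtain ⟨L, -, φ, hφ, hL⟩ := (isCompact_univ_pi fun i : ℕ × ℕ =>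
    (isCompact_Icc : IsCompact (Icc (-b i) (b i)))).tendsto_subseq
    (x := fun n i => ∫ x, ψ i x ∂(μ n)) fun n i _ => hb i n
  rw [tendsto_pi_nhds] at hL
  refine ⟨φ, hφ, fun g hg hgc => cauchySeq_tendsto_of_complete ?_⟩
  obtain ⟨k, hk⟩ := E.exists_superset_of_isCompact hgc
  have hgk : ∀ x, x ∉ E k → g x = 0 := fun x hx =>
    image_eq_zero_of_notMem_tsupport fun h => hx (hk h)
  let G : S k := ⟨⟨g, hg⟩, hgk⟩
  rw [Metric.cauchySeq_iff']
  intro η hη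
  have hη' : 0 < η / (4 * (M k + 1)) := by have := hM0 k; positivity
  -- a test function of the countable family that is uniformly close to `g`
  obtain ⟨n, hn⟩ : ∃ n, ∀ x ∈ E k, dist (g x) (ψ (k, n) x) < η / (4 * (M k + 1)) := by
    have h1 := (ContinuousMap.tendsto_iff_forall_isCompact_tendstoUniformlyOn.1
      (tendsto_id (x := 𝓝 (G : C(X, ℝ))))) (E k) (E.isCompact k)
    rw [Metric.tendstoUniformlyOn_iff] at h1
    have h2 := (continuous_subtype_val.continuousAt (x := G)).eventually (h1 _ hη')
    exact (TopologicalSpace.denseRange_denseSeq (S k)).mem_nhds h2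
  have happ : ∀ j, |∫ x, g x ∂(μ (φ j)) - ∫ x, ψ (k, n) x ∂(μ (φ j))| ≤ η / 4 := fun j => by
    have i1 : Integrable g (μ (φ j)) := hg.integrable_of_hasCompactSupport hgc
    have i2 : Integrable (ψ (k, n)) (μ (φ j)) :=
      (ψ (k, n)).continuous.integrable_of_hasCompactSupport
        (HasCompactSupport.intro (E.isCompact k) (hψ (k, n)))
    rw [← integral_sub i1 i2]
    refine (abs_integral_le_of_support_subset (hM k (φ j)) (hM0 k) (fun x hx => ?_)
      (fun x hx => (hn x hx).le) hη'.le).trans ?_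
    · rw [hgk x hx, hψ (k, n) x hx, sub_zero]
    · have := hM0 k
      rw [div_mul_eq_mul_div, div_le_div_iff₀ (by positivity) (by norm_num)]
      nlinarith
  obtain ⟨J, hJ⟩ := Metric.cauchySeq_iff'.1 (hL (k, n)).cauchySeq (η / 2) (by positivity)
  refine ⟨J, fun j hj => ?_⟩
  have h1 := hJ j hj
  have h2 := happ j
  have h3 := happ J
  simp only [Function.comp_apply, Real.dist_eq] at h1 ⊢
  rw [abs_lt] at h1 ⊢
  rw [abs_le] at h2 h3
  constructor <;> linarith

/-- Vague sequential compactness: the limit functional is represented by a measure according to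
the Riesz–Markov–Kakutani theorem. -/
theorem exists_subseq_tendsto_integral_measure [T2Space X] [LocallyCompactSpace X]
    [SecondCountableTopology X] (μ : ℕ → Measure X)
    (hμ : ∀ K, IsCompact K → ∃ M : ℝ, ∀ n, μ n K ≤ ENNReal.ofReal M) :
    ∃ φ : ℕ → ℕ, StrictMono φ ∧ ∃ ν : Measure X, ν.Regular ∧
      ∀ g : X → ℝ, Continuous g → HasCompactSupport g →
        Tendsto (fun j => ∫ x, g x ∂(μ (φ j))) atTop (𝓝 (∫ x, g x ∂ν)) := by
  have hfin : ∀ n, IsFiniteMeasureOnCompacts (μ n) := fun n => ⟨fun K hK => by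
    obtain ⟨M, hM⟩ := hμ K hK
    exact (hM n).trans_lt ENNReal.ofReal_lt_top⟩
  obtain ⟨φ, hφ, hlim⟩ := exists_subseq_tendsto_integral μ hμ
  have hlim' : ∀ g : CompactlySupportedContinuousMap X ℝ,
      ∃ l, Tendsto (fun j => ∫ x, g x ∂(μ (φ j))) atTop (𝓝 l) := fun g =>
    hlim g g.continuous g.hasCompactSupport
  choose Λ hΛ using hlim'
  let Λ' : CompactlySupportedContinuousMap X ℝ →ₚ[ℝ] ℝ :=
    { toFun := Λ
      map_add' := fun g h => tendsto_nhds_unique (hΛ (g + h)) (by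
        refine ((hΛ g).add (hΛ h)).congr fun j => ?_
        exact (integral_add g.integrable h.integrable).symm)
      map_smul' := fun c g => tendsto_nhds_unique (hΛ (c • g)) (by
        refine ((hΛ g).const_smul c).congr fun j => ?_
        exact (integral_smul c g).symm)
      monotone' := fun g h hgh => le_of_tendsto_of_tendsto' (hΛ g) (hΛ h) fun j =>
        integral_mono g.integrable h.integrable hgh }
  refine ⟨φ, hφ, RealRMK.rieszMeasure Λ', inferInstance, fun g hg hgc => ?_⟩
  have h1 := RealRMK.integral_rieszMeasure Λ' ⟨⟨g, hg⟩, hgc⟩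
  have h2 := hΛ ⟨⟨g, hg⟩, hgc⟩
  exact h1 ▸ h2

/-- The difference of two locally finite measures as a signed Radon measure. -/
theorem exists_signedRadonMeasure_integral_eq_sub [T2Space X] [LocallyCompactSpace X]
    [SecondCountableTopology X] (a b : Measure X) [IsLocallyFiniteMeasure a]
    [IsLocallyFiniteMeasure b] : ∃ σ : SignedRadonMeasure X, ∀ g : X → ℝ, Continuous g →
      HasCompactSupport g →
      (∫ x, g x ∂σ.pos) - ∫ x, g x ∂σ.neg = (∫ x, g x ∂a) - ∫ x, g x ∂b := by
  set p := a.rnDeriv (a + b) with hp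
  set q := b.rnDeriv (a + b) with hq
  have ha : (a + b).withDensity p = a :=
    Measure.withDensity_rnDeriv_eq _ _
      (Measure.absolutelyContinuous_of_le (Measure.le_add_right le_rfl))
  have hb : (a + b).withDensity q = b :=
    Measure.withDensity_rnDeriv_eq _ _
      (Measure.absolutelyContinuous_of_le (Measure.le_add_left le_rfl))
  have hpm : Measurable p := Measure.measurable_rnDeriv _ _
  have hqm : Measurable q := Measure.measurable_rnDeriv _ _
  set P := (a + b).withDensity (p - q) with hP
  set Q := (a + b).withDensity (q - p) with hQ
  have hPa : P ≤ a := by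
    conv_rhs => rw [← ha]
    exact withDensity_mono (ae_of_all _ fun x => tsub_le_self)
  have hQb : Q ≤ b := by
    conv_rhs => rw [← hb]
    exact withDensity_mono (ae_of_all _ fun x => tsub_le_self)
  have hPf : IsLocallyFiniteMeasure P := Measure.isLocallyFiniteMeasure_of_le hPa
  have hQf : IsLocallyFiniteMeasure Q := Measure.isLocallyFiniteMeasure_of_le hQb
  have hsum : P + b = Q + a := by
    conv_lhs => rw [← hb]
    conv_rhs => rw [← ha]
    rw [hP, hQ, ← withDensity_add_right _ hqm, ← withDensity_add_right _ hpm]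
    congr 1
    funext x
    simp only [Pi.add_apply, Pi.sub_apply, tsub_add_eq_max, max_comm]
  have hms : P ⟂ₘ Q := by
    have hset : MeasurableSet {x | p x ≤ q x} := measurableSet_le hpm hqm
    refine ⟨{x | p x ≤ q x}, hset, ?_, ?_⟩
    · rw [hP, withDensity_apply _ hset, setLIntegral_eq_zero_iff hset (hpm.sub hqm)]
      exact ae_of_all _ fun x hx => tsub_eq_zero_of_le hx
    · rw [hQ, withDensity_apply _ hset.compl, setLIntegral_eq_zero_iff hset.compl (hqm.sub hpm)]
      exact ae_of_all _ fun x hx => tsub_eq_zero_of_le (not_le.1 (show ¬ p x ≤ q x from hx)).le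
  refine ⟨⟨P, Q, hPf, hQf, inferInstance, inferInstance, hms⟩, fun g hg hgc => ?_⟩
  have hint : ∀ (m : Measure X) [IsLocallyFiniteMeasure m], Integrable g m := fun m _ =>
    hg.integrable_of_hasCompactSupport hgc
  have h1 := congrArg (fun m => ∫ x, g x ∂m) hsum
  simp only [integral_add_measure (hint P) (hint b), integral_add_measure (hint Q) (hint a)] at h1
  simp only
  linarith

end Vague

lemma integral_mul_max_zero {X : Type*} [MeasurableSpace X] {m : Measure X} {w : X → ℝ}
    (hw : AEMeasurable w m) (g : X → ℝ) :
    ∫ x, g x ∂(m.withDensity fun x => ENNReal.ofReal (w x)) = ∫ x, g x * max (w x) 0 ∂m := by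
  rw [integral_withDensity_eq_integral_toReal_smul₀ hw.ennreal_ofReal
    (ae_of_all _ fun x => ENNReal.ofReal_lt_top)]
  refine integral_congr_ae (ae_of_all _ fun x => ?_)
  simp only [ENNReal.toReal_ofReal', smul_eq_mul]
  ring

section VagueDensities

variable {X : Type*} [TopologicalSpace X] [MeasurableSpace X] [BorelSpace X] [T2Space X]
  [LocallyCompactSpace X] [SecondCountableTopology X]

lemma exists_subseq_tendsto_integral_mul_max_zero {m : Measure X} {w : ℕ → X → ℝ}
    (hw : ∀ n, AEMeasurable (w n) m)
    (hb : ∀ K, IsCompact K → ∃ M : ℝ, ∀ n, ∫⁻ x in K, ‖w n x‖ₑ ∂m ≤ ENNReal.ofReal M) :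
    ∃ φ : ℕ → ℕ, StrictMono φ ∧ ∃ ν : Measure X, ν.Regular ∧
      ∀ g : X → ℝ, Continuous g → HasCompactSupport g →
        Tendsto (fun j => ∫ x, g x * max (w (φ j) x) 0 ∂m) atTop (𝓝 (∫ x, g x ∂ν)) := by
  obtain ⟨φ, hφ, ν, hν, h⟩ := exists_subseq_tendsto_integral_measure
    (fun n => m.withDensity fun x => ENNReal.ofReal (w n x)) fun K hK => by
      obtain ⟨M, hM⟩ := hb K hK
      refine ⟨M, fun n => le_trans ?_ (hM n)⟩
      rw [withDensity_apply _ hK.measurableSet]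
      refine lintegral_mono fun x => ?_
      rw [Real.enorm_eq_ofReal_abs]
      exact ENNReal.ofReal_le_ofReal (le_abs_self _)
  refine ⟨φ, hφ, ν, hν, fun g hg hgc => ?_⟩
  refine (h g hg hgc).congr fun j => ?_
  exact integral_mul_max_zero (hw _) g

/-- Locally bounded sequences of densities have subsequences that converge weakly* to a signed Radon
measure. -/
theorem exists_subseq_tendsto_integral_mul {m : Measure X} {w : ℕ → X → ℝ}
    (hw : ∀ n, AEMeasurable (w n) m)
    (hb : ∀ K, IsCompact K → ∃ M : ℝ, ∀ n, ∫⁻ x in K, ‖w n x‖ₑ ∂m ≤ ENNReal.ofReal M) :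
    ∃ φ : ℕ → ℕ, StrictMono φ ∧ ∃ σ : SignedRadonMeasure X,
      ∀ g : X → ℝ, Continuous g → HasCompactSupport g →
        Tendsto (fun j => ∫ x, g x * w (φ j) x ∂m) atTop
          (𝓝 ((∫ x, g x ∂σ.pos) - ∫ x, g x ∂σ.neg)) := by
  obtain ⟨φ₁, hφ₁, a, ha, h₁⟩ := exists_subseq_tendsto_integral_mul_max_zero hw hb
  obtain ⟨φ₂, hφ₂, b, hb', h₂⟩ := exists_subseq_tendsto_integral_mul_max_zero
    (w := fun n x => -w (φ₁ n) x) (fun n => (hw _).neg) fun K hK => by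
      obtain ⟨M, hM⟩ := hb K hK
      exact ⟨M, fun n => by simpa only [enorm_neg] using hM (φ₁ n)⟩
  obtain ⟨σ, hσ⟩ := exists_signedRadonMeasure_integral_eq_sub a b
  refine ⟨φ₁ ∘ φ₂, hφ₁.comp hφ₂, σ, fun g hg hgc => ?_⟩
  rw [hσ g hg hgc]
  refine (((h₁ g hg hgc).comp hφ₂.tendsto_atTop).sub (h₂ g hg hgc)).congr fun j => ?_
  have hloc : Integrable (fun x => g x * w (φ₁ (φ₂ j)) x) m := by
    obtain ⟨M, hM⟩ := hb _ hgc
    obtain ⟨c, hc⟩ := hgc.exists_bound_of_continuousOn hg.continuousOn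
    have hon : IntegrableOn (w (φ₁ (φ₂ j))) (tsupport g) m :=
      ⟨(hw _).aestronglyMeasurable.restrict, (hM _).trans_lt ENNReal.ofReal_lt_top⟩
    have hon' : IntegrableOn (fun x => g x * w (φ₁ (φ₂ j)) x) (tsupport g) m :=
      Integrable.bdd_mul hon hg.aestronglyMeasurable.restrict
        ((ae_restrict_iff' hgc.measurableSet).2 (ae_of_all _ hc))
    refine (integrableOn_iff_integrable_of_support_subset fun x hx => ?_).1 hon'
    exact subset_tsupport g fun h => hx (by simp [h])
  have hpos : ∀ s : ℝ, s = 1 ∨ s = -1 →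
      Integrable (fun x => g x * max (s * w (φ₁ (φ₂ j)) x) 0) m := by
    intro s hs
    refine hloc.mono (hg.aestronglyMeasurable.mul
      (((hw _).const_mul s).max aemeasurable_const).aestronglyMeasurable) (ae_of_all _ fun x => ?_)
    rw [norm_mul, norm_mul]
    refine mul_le_mul_of_nonneg_left ?_ (norm_nonneg _)
    rw [Real.norm_eq_abs, Real.norm_eq_abs, abs_of_nonneg (le_max_right _ _)]
    refine max_le ?_ (abs_nonneg _)
    rcases hs with rfl | rfl
    · rw [one_mul]; exact le_abs_self _
    · rw [neg_one_mul]; exact neg_le_abs _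
  have i1 := hpos 1 (.inl rfl)
  have i2 := hpos (-1) (.inr rfl)
  simp only [one_mul, neg_one_mul] at i1 i2
  simp only [Function.comp_apply]
  rw [← integral_sub i1 i2]
  refine integral_congr_ae (ae_of_all _ fun x => ?_)
  simp only
  rcases le_total 0 (w (φ₁ (φ₂ j)) x) with hz | hz
  · rw [max_eq_left hz, max_eq_right (neg_nonpos.2 hz)]; ring
  · rw [max_eq_right hz, max_eq_left (neg_nonneg.2 hz)]; ring

/-- Locally bounded sequences of nonnegative densities have subsequences that converge weakly* to a
nonnegative Radon measure. -/
theorem exists_subseq_tendsto_integral_mul_of_nonneg {m : Measure X} {w : ℕ → X → ℝ}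
    (hw : ∀ n, AEMeasurable (w n) m) (hw0 : ∀ n, ∀ᵐ x ∂m, 0 ≤ w n x)
    (hb : ∀ K, IsCompact K → ∃ M : ℝ, ∀ n, ∫⁻ x in K, ‖w n x‖ₑ ∂m ≤ ENNReal.ofReal M) :
    ∃ φ : ℕ → ℕ, StrictMono φ ∧ ∃ σ : SignedRadonMeasure X, σ.neg = 0 ∧
      ∀ g : X → ℝ, Continuous g → HasCompactSupport g →
        Tendsto (fun j => ∫ x, g x * w (φ j) x ∂m) atTop
          (𝓝 ((∫ x, g x ∂σ.pos) - ∫ x, g x ∂σ.neg)) := by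
  obtain ⟨φ, hφ, a, ha, h⟩ := exists_subseq_tendsto_integral_mul_max_zero hw hb
  refine ⟨φ, hφ, ⟨a, 0, inferInstance, inferInstance, ha, inferInstance,
    Measure.MutuallySingular.zero_right⟩, rfl, fun g hg hgc => ?_⟩
  simp only [integral_zero_measure, sub_zero]
  refine (h g hg hgc).congr fun j => integral_congr_ae ?_
  filter_upwards [hw0 (φ j)] with x hx
  rw [max_eq_left hx]

end VagueDensities

/-! ### Slices of the half-plane -/

namespace HalfPlane

instance : LocallyCompactSpace HalfPlane :=
  (isClosed_le continuous_const continuous_snd).isClosedEmbedding_subtypeVal.locallyCompactSpace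

/-- The half-plane with its Lebesgue measure is the product of the time axis and the line. -/
lemma measurePreserving_time_space : MeasurePreserving (fun p : HalfPlane => (p.1.2, p.1.1)) volume
    ((volume.restrict (Ici (0 : ℝ))).prod volume) := by
  have hs : MeasurableSet {p : ℝ × ℝ | 0 ≤ p.2} :=
    (isClosed_le continuous_const continuous_snd).measurableSet
  have h1 : MeasurePreserving (Subtype.val : HalfPlane → ℝ × ℝ) volume
      (volume.restrict {p : ℝ × ℝ | 0 ≤ p.2}) :=
    ⟨measurable_subtype_coe, map_comap_subtype_coe hs _⟩
  have h2 : (volume.restrict {p : ℝ × ℝ | 0 ≤ p.2} : Measure (ℝ × ℝ)) =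
      volume.prod (volume.restrict (Ici (0 : ℝ))) := by
    rw [show {p : ℝ × ℝ | 0 ≤ p.2} = univ ×ˢ Ici 0 by ext; simp, Measure.volume_eq_prod,
      ← Measure.prod_restrict, Measure.restrict_univ]
  rw [h2] at h1
  exact Measure.measurePreserving_swap.comp h1

lemma measurableEmbedding_time_space :
    MeasurableEmbedding (fun p : HalfPlane => (p.1.2, p.1.1)) :=
  MeasurableEquiv.prodComm.measurableEmbedding.comp (MeasurableEmbedding.subtype_coe
    (isClosed_le continuous_const continuous_snd).measurableSet)

variable {w : ℝ → ℝ → ℝ}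

lemma aemeasurable_time_space (hw : AEMeasurable fun p : HalfPlane => w p.1.1 p.1.2) :
    AEMeasurable (fun q : ℝ × ℝ => w q.2 q.1) ((volume.restrict (Ici (0 : ℝ))).prod volume) := by
  rw [← measurePreserving_time_space.map_eq, measurableEmbedding_time_space.aemeasurable_map_iff]
  exact hw

/-- A closed condition that holds almost everywhere in each time slice holds almost everywhere. -/
lemma ae_of_forall_slice (hw : AEMeasurable fun p : HalfPlane => w p.1.1 p.1.2) {s : Set ℝ}
    (hs : IsClosed s) {T : ℝ} (h : ∀ t, 0 < t → t ≤ T → ∀ᵐ x, w x t ∈ s) :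
    ∀ᵐ p : HalfPlane, p.1.2 ≤ T → w p.1.1 p.1.2 ∈ s := by
  have hF := aemeasurable_time_space hw
  have hmk := hF.ae_eq_mk
  have hmeas : MeasurableSet {q : ℝ × ℝ | q.1 ≤ T → hF.mk _ q ∈ s} :=
    (measurableSet_le measurable_fst measurable_const).himp
      (hF.measurable_mk hs.measurableSet)
  have hae : ∀ᵐ q ∂((volume.restrict (Ici (0 : ℝ))).prod volume), q.1 ≤ T → hF.mk _ q ∈ s := by
    refine (Measure.ae_prod_iff_ae_ae hmeas).2 ?_
    have h0 : ∀ᵐ t ∂(volume.restrict (Ici (0 : ℝ))), 0 < t := by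
      rw [ae_restrict_iff' measurableSet_Ici]
      have hne : ∀ᵐ t : ℝ, t ≠ 0 := by simp [ae_iff]
      filter_upwards [hne] with t h1 h2
      exact lt_of_le_of_ne h2 (Ne.symm h1)
    filter_upwards [h0, Measure.ae_ae_of_ae_prod hmk] with t ht hmt
    by_cases htT : t ≤ T
    · filter_upwards [hmt, h t ht htT] with x h1 h2 _
      rw [← h1]
      exact h2
    · exact ae_of_all _ fun x hx => absurd hx htT
  have hae' : ∀ᵐ q ∂((volume.restrict (Ici (0 : ℝ))).prod volume), q.1 ≤ T → w q.2 q.1 ∈ s := by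
    filter_upwards [hae, hmk] with q h1 h2 h3
    rw [h2]
    exact h1 h3
  exact measurePreserving_time_space.quasiMeasurePreserving.ae hae'

/-- A bound for the time slices of an integral. -/
lemma lintegral_le_of_forall_slice (hw : AEMeasurable fun p : HalfPlane => w p.1.1 p.1.2)
    {L T c : ℝ} (hc : 0 ≤ c)
    (h : ∀ t, 0 < t → t ≤ T → ∫⁻ x in Icc (-L) L, ‖w x t‖ₑ ≤ ENNReal.ofReal c)
    {K : Set HalfPlane} (hK : ∀ p ∈ K, |p.1.1| ≤ L ∧ p.1.2 ≤ T) :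
    ∫⁻ p in K, ‖w p.1.1 p.1.2‖ₑ ≤ ENNReal.ofReal (c * T) := by
  have hF := aemeasurable_time_space hw
  set S : Set (ℝ × ℝ) := Icc 0 T ×ˢ Icc (-L) L with hS
  have hKS : K ⊆ (fun p : HalfPlane => (p.1.2, p.1.1)) ⁻¹' S := fun p hp =>
    ⟨⟨p.2, (hK p hp).2⟩, abs_le.1 (hK p hp).1⟩
  refine (lintegral_mono_set hKS).trans ?_
  have e := measurePreserving_time_space.setLIntegral_comp_preimage_emb
    measurableEmbedding_time_space (fun q : ℝ × ℝ => ‖w q.2 q.1‖ₑ) S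
  rw [e, hS, ← Measure.prod_restrict, Measure.restrict_restrict measurableSet_Icc,
    inter_eq_left.2 Icc_subset_Ici_self, lintegral_prod]
  · have h0 : ∀ᵐ t ∂(volume.restrict (Icc (0 : ℝ) T)),
        ∫⁻ x in Icc (-L) L, ‖w x t‖ₑ ≤ ENNReal.ofReal c := by
      rw [ae_restrict_iff' measurableSet_Icc]
      have hne : ∀ᵐ t : ℝ, t ≠ 0 := by simp [ae_iff]
      filter_upwards [hne] with t h1 h2
      exact h t (lt_of_le_of_ne h2.1 (Ne.symm h1)) h2.2
    refine (lintegral_mono_ae h0).trans ?_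
    rw [setLIntegral_const, Real.volume_Icc, sub_zero, ENNReal.ofReal_mul hc]
  · refine hF.enorm.mono_measure ?_
    exact Measure.prod_mono (Measure.restrict_mono Icc_subset_Ici_self le_rfl)
      Measure.restrict_le_self

lemma exists_bounds_of_isCompact {K : Set HalfPlane} (hK : IsCompact K) :
    ∃ L, 0 ≤ L ∧ ∀ p ∈ K, |p.1.1| ≤ L ∧ p.1.2 ≤ L := by
  obtain ⟨a, ha⟩ := hK.exists_bound_of_continuousOn
    (continuous_fst.comp continuous_subtype_val).continuousOn
  obtain ⟨b, hb⟩ := hK.exists_bound_of_continuousOn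
    (continuous_snd.comp continuous_subtype_val).continuousOn
  refine ⟨max (max a b) 0, le_max_right _ _, fun p hp => ⟨?_, ?_⟩⟩
  · exact (ha p hp).trans ((le_max_left _ _).trans (le_max_left _ _))
  · exact (le_abs_self _).trans ((hb p hp).trans ((le_max_right _ _).trans (le_max_left _ _)))

end HalfPlane

/-! ### The approximate solutions -/

lemma cellValue_of_forall {w₀ R : ℝ} {w : ℝ → ℝ} {Y : ℕ → ℝ} {P : ℝ → Prop} (h₀ : P w₀)
    (h : ∀ x, R ≤ x → P (w x)) (hY : ∀ i, R ≤ Y i) (i : ℕ) : P (cellValue w₀ w Y i) := by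
  cases i with
  | zero => exact h₀
  | succ i => exact h _ (hY _)

/-- Bounds which hold for a whole sequence of piecewise constant approximations of the data. -/
lemma exists_forall_dataBounds {f κ ua : ℝ → ℝ} (hf' : StrictMono f)
    (hc : RelaxationCoefficients κ ua) {R v₀ u₀ : ℝ} (hv₀ : 0 < v₀) {v u : ℝ → ℝ}
    (hv : ∀ x, R ≤ x → 0 < v x) (hvb : ∃ M, ∀ x, R ≤ x → v x ≤ M)
    (hub : ∃ M, ∀ x, R ≤ x → |u x| ≤ M) {Y : ℕ → ℕ → ℝ} (hY0 : ∀ ν, Y ν 0 = R)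
    {g : ℕ → ℝ} (hg : ∀ ν, 0 < g ν) (hYl : ∀ ν i, g ν < Y ν (i + 1) - Y ν i)
    {G : ℝ} (hYu : ∀ ν i, Y ν (i + 1) - Y ν i ≤ G) (T : ℝ) :
    ∃ N B F, ∀ ν, DataBounds f κ ua (cellValue v₀ v (Y ν)) (cellValue u₀ u (Y ν)) (Y ν)
      T N B F G := by
  obtain ⟨Mv, hMv⟩ := hvb
  obtain ⟨Mu, hMu⟩ := hub
  obtain ⟨B, hB⟩ := hc.exists_abs_relax_le (max |u₀| Mu) T
  have hmono : ∀ ν, Monotone (Y ν) := fun ν =>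
    monotone_nat_of_le_succ fun i => by linarith [hg ν, hYl ν i]
  have hR : ∀ ν i, R ≤ Y ν i := fun ν i => (hY0 ν).symm.le.trans (hmono ν (Nat.zero_le i))
  have hus : ∀ ν i, |cellValue u₀ u (Y ν) i| ≤ max |u₀| Mu := fun ν =>
    cellValue_of_forall (P := fun y => |y| ≤ max |u₀| Mu) (le_max_left _ _)
      (fun x hx => (hMu x hx).trans (le_max_right _ _)) (hR ν)
  refine ⟨max v₀ Mv, B, max |f B| |f (-B)|, fun ν => ⟨?_, ?_, ?_, ?_, hmono ν, hYu ν, ?_⟩⟩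
  · exact cellValue_of_forall (P := fun y => 0 < y) hv₀ hv (hR ν)
  · exact cellValue_of_forall (P := fun y => y ≤ max v₀ Mv) (le_max_left _ _)
      (fun x hx => (hMv x hx).trans (le_max_right _ _)) (hR ν)
  · exact fun i t ht => hB _ (hus ν i) t ht
  · intro i t ht
    have h1 := abs_le.1 (hB _ (hus ν i) t ht)
    have h2 := hf'.monotone h1.1
    have h3 := hf'.monotone h1.2
    refine abs_le.2 ⟨?_, ?_⟩
    · linarith [neg_abs_le (f (-B)), le_max_right |f B| |f (-B)|]
    · linarith [le_abs_self (f B), le_max_left |f B| |f (-B)|]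
  · have hlin : ∀ i : ℕ, R + i * g ν ≤ Y ν i := fun i => by
      induction i with
      | zero => simp [hY0]
      | succ i ih =>
        push_cast
        linarith [hYl ν i]
    refine tendsto_atTop_mono hlin (tendsto_atTop_add_const_left _ _ ?_)
    exact tendsto_natCast_atTop_atTop.atTop_mul_const (hg ν)

theorem theorem1p2
    (f κ ua : ℝ → ℝ) (hf : ContDiff ℝ 1 f) (hf' : StrictMono f)
    (hκ : Measurable κ) (hκb : LocallyBoundedOnTimes κ)
    (hua : Measurable ua) (huab : LocallyBoundedOnTimes ua)
    (R v₀ u₀ : ℝ) (hv₀ : 0 < v₀) (v u : ℝ → ℝ)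
    (hv : ∀ x, R ≤ x → 0 < v x) (hvb : ∃ M, ∀ x, R ≤ x → v x ≤ M)
    (hu : ContinuousOn u (Ici R)) (hub : ∃ M, ∀ x, R ≤ x → |u x| ≤ M)
    (hue : FinitelyManyExtremes u R)
    (ε : ℕ → ℝ) (hε : ∀ ν, 0 < ε ν) (hε0 : Tendsto ε atTop (𝓝 0))
    (C₁ C₂ α : ℝ) (hC₁ : 1 ≤ C₁) (hC₂ : 1 ≤ C₂) (hα : α ∈ Ioo (0 : ℝ) 1)
    (ρ : ℝ → ℝ) (hρ : Tendsto ρ (𝓝[>] 0) (𝓝 0))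
    (Y : ℕ → ℕ → ℝ) (hY0 : ∀ ν, Y ν 0 = R)
    (hYl : ∀ ν i, C₁ * ε ν ^ α < Y ν (i + 1) - Y ν i)
    (hYu : ∀ ν i, Y ν (i + 1) - Y ν i < C₂ * ρ (ε ν))
    (C : ℝ) (δ : ℕ → ℝ) (hδ : Tendsto δ atTop (𝓝 0))
    (U : ∀ ν, ShadowWaveApproximation f κ ua (cellValue v₀ v (Y ν)) (cellValue u₀ u (Y ν)) (Y ν)
      (ε ν) C (δ ν))
    (hUv : ∀ ν, AEMeasurable fun p : HalfPlane => (U ν).v p.1.1 p.1.2)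
    (hUu : ∀ ν, AEMeasurable fun p : HalfPlane => (U ν).u p.1.1 p.1.2) :
    (∀ K : Set HalfPlane, IsCompact K → ∃ M : ℝ, ∀ ν,
      IntegrableOn (fun p : HalfPlane => (U ν).v p.1.1 p.1.2) K ∧
      ∫ p in K, |(U ν).v p.1.1 p.1.2| ≤ M ∧
      ∀ᵐ p : HalfPlane, p ∈ K → |(U ν).u p.1.1 p.1.2| ≤ M) ∧
    ∃ n : ℕ → ℕ, StrictMono n ∧ ∃ vlim ulim : SignedRadonMeasure HalfPlane,
      vlim.neg = 0 ∧
      WeakStarTendsto (fun j => (U (n j)).v) vlim ∧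
      WeakStarTendsto (fun j => (U (n j)).u) ulim := by

  have hc : RelaxationCoefficients κ ua := ⟨hκ, hκb, hua, huab⟩
  have hfc : Continuous f := hf.continuous
  -- bounds for the parameters of the sequence
  have hρε : Tendsto (fun ν => C₂ * ρ (ε ν)) atTop (𝓝 (C₂ * 0)) :=
    (hρ.comp (tendsto_nhdsWithin_iff.2 ⟨hε0, Eventually.of_forall hε⟩)).const_mul C₂
  obtain ⟨G, hG⟩ := hρε.bddAbove_range
  obtain ⟨E, hE⟩ := hε0.bddAbove_range
  obtain ⟨D, hD⟩ := hδ.abs.bddAbove_range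
  have hGν : ∀ ν i, Y ν (i + 1) - Y ν i ≤ G := fun ν i => (hYu ν i).le.trans (hG ⟨ν, rfl⟩)
  have hEν : ∀ ν, ε ν ≤ E := fun ν => hE ⟨ν, rfl⟩
  have hDν : ∀ ν, |δ ν| ≤ D := fun ν => hD ⟨ν, rfl⟩
  have hbounds := exists_forall_dataBounds hf' hc hv₀ (u₀ := u₀) hv hvb hub hY0
    (fun ν => mul_pos (zero_lt_one.trans_le hC₁) (Real.rpow_pos_of_pos (hε ν) α)) hYl hGν
  -- the density and the velocity in a bounded region
  have hvK : ∀ K : Set HalfPlane, IsCompact K → ∃ M : ℝ, 0 ≤ M ∧ ∀ ν,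
      ∫⁻ p in K, ‖(U ν).v p.1.1 p.1.2‖ₑ ≤ ENNReal.ofReal M := by
    intro K hK
    obtain ⟨L, hL, hKL⟩ := HalfPlane.exists_bounds_of_isCompact hK
    obtain ⟨N, B, F, hb⟩ := hbounds L
    have hN := (hb 0).density_bound_nonneg
    have hF := (hb 0).speed_bound_nonneg hL
    have hD0 : 0 ≤ D := (abs_nonneg _).trans (hDν 0)
    set c := N * (2 * L) + (1 + D) *
      (N * (max 0 (L + E * (L / 2 + |C|) + F * L + G - R) + 2 * F * L)) with hcdef
    have hc0 : 0 ≤ c := by positivity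
    refine ⟨c * L, mul_nonneg hc0 hL, fun ν =>
      HalfPlane.lintegral_le_of_forall_slice (hUv ν) hc0 (fun t ht0 htL => ?_) hKL⟩
    refine ((U ν).lintegral_v_le hc hfc hf' (hb ν) ⟨ht0.le, htL⟩ ht0 (hε ν) hL).trans
      (ENNReal.ofReal_le_ofReal ?_)
    rw [hcdef, hY0 ν]
    have h1 : max 0 (L + ε ν * (L / 2 + |C|) + F * L + G - R) ≤
        max 0 (L + E * (L / 2 + |C|) + F * L + G - R) := by
      have := mul_le_mul_of_nonneg_right (hEν ν) (show 0 ≤ L / 2 + |C| by positivity)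
      exact max_le_max le_rfl (by linarith)
    have h2 := hDν ν
    gcongr
  have huT : ∀ L : ℝ, 0 ≤ L → ∃ M : ℝ, 0 ≤ M ∧ ∀ ν t, 0 < t → t ≤ L →
      ∀ᵐ x, |(U ν).u x t| ≤ M := by
    intro L hL
    obtain ⟨N, B, F, hb⟩ := hbounds L
    refine ⟨B + D, ?_, fun ν t ht0 htL => ?_⟩
    · exact add_nonneg ((abs_nonneg _).trans ((hb 0).velocity_le 0 0 ⟨le_rfl, hL⟩))
        ((abs_nonneg _).trans (hDν 0))
    · filter_upwards [((U ν).countable_exceptionalSet t).ae_notMem volume] with x hx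
      exact ((U ν).abs_u_le hc hfc hf' (hb ν) ⟨ht0.le, htL⟩ ht0 hx).trans
        (add_le_add le_rfl (hDν ν))
  have huK : ∀ K : Set HalfPlane, IsCompact K → ∃ M : ℝ, ∀ ν,
      ∫⁻ p in K, ‖(U ν).u p.1.1 p.1.2‖ₑ ≤ ENNReal.ofReal M := by
    intro K hK
    obtain ⟨L, hL, hKL⟩ := HalfPlane.exists_bounds_of_isCompact hK
    obtain ⟨M, hM0, hM⟩ := huT L hL
    refine ⟨M * (2 * L) * L, fun ν => HalfPlane.lintegral_le_of_forall_slice (hUu ν)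
      (by positivity) (fun t ht0 htL => ?_) hKL⟩
    calc ∫⁻ x in Icc (-L) L, ‖(U ν).u x t‖ₑ ≤ ∫⁻ x in Icc (-L) L, ENNReal.ofReal M := by
          refine lintegral_mono_ae (ae_restrict_of_ae ?_)
          filter_upwards [hM ν t ht0 htL] with x hx
          rw [Real.enorm_eq_ofReal_abs]
          exact ENNReal.ofReal_le_ofReal hx
      _ = ENNReal.ofReal (M * (2 * L)) := by
          rw [setLIntegral_const, Real.volume_Icc, ENNReal.ofReal_mul hM0,
            show L - -L = 2 * L by ring]
  refine ⟨fun K hK => ?_, ?_⟩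
  · obtain ⟨M₁, hM₁, hv₁⟩ := hvK K hK
    obtain ⟨L, hL, hKL⟩ := HalfPlane.exists_bounds_of_isCompact hK
    obtain ⟨M₂, -, hu₂⟩ := huT L hL
    refine ⟨max M₁ M₂, fun ν => ⟨⟨(hUv ν).aestronglyMeasurable.restrict,
      (hv₁ ν).trans_lt ENNReal.ofReal_lt_top⟩, ?_, ?_⟩⟩
    · refine le_trans ?_ (le_max_left _ _)
      simp only [← Real.norm_eq_abs]
      rw [integral_norm_eq_lintegral_enorm (hUv ν).aestronglyMeasurable.restrict]
      exact ENNReal.toReal_le_of_le_ofReal hM₁ (hv₁ ν)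
    · filter_upwards [HalfPlane.ae_of_forall_slice (hUu ν) (s := {y | |y| ≤ M₂})
        (isClosed_le continuous_abs continuous_const) (hu₂ ν)] with p hp hpK
      exact (hp (hKL p hpK).2).trans (le_max_right _ _)
  -- the approximate densities are nonnegative as soon as `δ ν < 1`
  · obtain ⟨n₀, hn₀⟩ := eventually_atTop.1 (hδ.eventually_lt_const zero_lt_one)
    have hpos : ∀ j, ∀ᵐ p : HalfPlane, 0 ≤ (U (j + n₀)).v p.1.1 p.1.2 := by
      intro j
      have hT : ∀ T : ℕ, ∀ᵐ p : HalfPlane, p.1.2 ≤ T → (U (j + n₀)).v p.1.1 p.1.2 ∈ Ici 0 := by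
        intro T
        obtain ⟨N, B, F, hb⟩ := hbounds T
        refine HalfPlane.ae_of_forall_slice (hUv _) isClosed_Ici fun t ht0 htT => ?_
        filter_upwards [((U (j + n₀)).countable_exceptionalSet t).ae_notMem volume] with x hx
        exact (U (j + n₀)).v_nonneg hc hfc hf' (hb _) ⟨ht0.le, htT⟩ ht0 hx
          (hn₀ _ (Nat.le_add_left _ _))
      filter_upwards [ae_all_iff.2 hT] with p hp
      obtain ⟨T, hT⟩ := exists_nat_ge p.1.2
      exact hp T hT
    obtain ⟨φ₁, hφ₁, vlim, hneg, hvlim⟩ := exists_subseq_tendsto_integral_mul_of_nonneg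
      (w := fun j (p : HalfPlane) => (U (j + n₀)).v p.1.1 p.1.2) (fun j => hUv _) hpos
      fun K hK => by
        obtain ⟨M, -, hM⟩ := hvK K hK
        exact ⟨M, fun j => hM _⟩
    obtain ⟨φ₂, hφ₂, ulim, hulim⟩ := exists_subseq_tendsto_integral_mul
      (w := fun j (p : HalfPlane) => (U (φ₁ j + n₀)).u p.1.1 p.1.2) (fun j => hUu _)
      fun K hK => by
        obtain ⟨M, hM⟩ := huK K hK
        exact ⟨M, fun j => hM _⟩
    refine ⟨fun j => φ₁ (φ₂ j) + n₀, fun i j hij => Nat.add_lt_add_right (hφ₁ (hφ₂ hij)) n₀,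
      vlim, ulim, hneg, fun φ hφ hφc => ?_, fun φ hφ hφc => hulim φ hφ hφc⟩
    exact (hvlim φ hφ hφc).comp hφ₂.tendsto_atTop
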